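/- Let $m,l\in\mathbb R$ with $4m-l^2\neq 0$, put $F=1+m(x^2+y^2)$, and let the (3-dimensional) BCV space $M^3_{m,l}$ be the set of points $(x,y,z)\in\mathbb R^3$ with $F\neq0$, equipped with the Riemannian metric $$g=\frac{dx^2+dy^2}{F^2}+\Big[dz+\frac l2\,\frac{y\,dx-x\,dy}{F}\Big]^2 ,$$ with its global orthonormal frame $E_1=F\frac{\partial}{\partial x}-\frac{ly}{2}\frac{\partial}{\partial z}$, $E_2=F\frac{\partial}{\partial y}+\frac{lx}{2}\frac{\partial}{\partial z}$, $E_3=\frac{\partial}{\partial z}$. Let $\Omega\subseteq M^3_{m,l}$ be open (for instance the whole space, or the component $\{F>0\}$), let $(N^2,h)$ be a smooth Riemannian surface, and let $\pi:(\Omega,g)\to(N^2,h)$ be a Riemannian submersion, i.e. a smooth submersion (not required to be onto) whose differential preserves the inner products of horizontal vectors. Let $p\in\Omega$ be a point such that either $E_3$ is vertical (tangent to the fibres of $\pi$) on a neighbourhood of $p$, or $E_3$ is not vertical at $p$. Then on some open neighbourhood $U\subseteq\Omega$ of $p$ there is a smooth orthonormal frame $\{e_1,e_2,e_3\}$ adapted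 to $\pi$, with $e_3$ vertical and $$e_1=a_1^1E_1+a_1^2E_2,\qquad a_1^1,a_1^2\in C^\infty(U),$$ that is, $e_1$ has no $E_3$-component. Here "adapted" means that $e_1,e_2$ are horizontal and basic: there are an open set $V\supseteq\pi(U)$ of $N$ and a smooth orthonormal frame $\{\eta_1,\eta_2\}$ of $(N^2,h)$ on $V$ with $d\pi(e_i(q))=\eta_i(\pi(q))$ for all $q\in U$, $i=1,2$. In particular such frames exist near every point if $E_3$ is vertical everywhere or nowhere vertical. -/

import Mathlib

open scoped Manifold ContDiff Topology Bundle

namespace BCV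

/-- The coordinate space `ℝ³` with coordinates `(x, y, z) = (p 0, p 1, p 2)`. Only its smooth
structure is used; the Riemannian metric on it is `BCV.metric` below. -/
abbrev R3 : Type := EuclideanSpace ℝ (Fin 3)

/-- `F = 1 + m (x² + y²)`. -/
def F (m : ℝ) (p : R3) : ℝ := 1 + m * (p 0 ^ 2 + p 1 ^ 2)

/-- The points of `ℝ³` at which the Bianchi-Cartan-Vranceanu metric is defined. It is all of `ℝ³`
for `m ≥ 0`; for `m < 0` it consists of the solid cylinder `F > 0` (the usual BCV space)
and of the outer region `F < 0`. -/
def space (m : ℝ) : Set R3 := {p | F m p ≠ 0}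

/-- The one-form `dz + (l/2) (y dx - x dy) / F` at the point `p`. -/
noncomputable def theta (m l : ℝ) (p u : R3) : ℝ :=
  u 2 + l / 2 * ((p 1 * u 0 - p 0 * u 1) / F m p)

/-- The BCV metric `(dx² + dy²) / F² + (dz + (l/2) (y dx - x dy) / F)²` at the point `p`,
evaluated on the tangent vectors `u` and `v`. -/
noncomputable def metric (m l : ℝ) (p u v : R3) : ℝ :=
  (u 0 * v 0 + u 1 * v 1) / F m p ^ 2 + theta m l p u * theta m l p v

/-- `E₁ = F ∂/∂x - (l y / 2) ∂/∂z`. -/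
noncomputable def E1 (m l : ℝ) (p : R3) : R3 := !₂[F m p, 0, -(l * p 1 / 2)]

/-- `E₂ = F ∂/∂y + (l x / 2) ∂/∂z`. -/
noncomputable def E2 (m l : ℝ) (p : R3) : R3 := !₂[0, F m p, l * p 0 / 2]

/-- `E₃ = ∂/∂z`. -/
noncomputable def E3 (_p : R3) : R3 := !₂[0, 0, 1]

section Submersion

variable {N : Type*} [TopologicalSpace N] [ChartedSpace (EuclideanSpace ℝ (Fin 2)) N]

/-- The differential of `φ : ℝ³ → N` at `p`, with the tangent space of `ℝ³` at `p` identified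
with `ℝ³`. -/
noncomputable def diff (φ : R3 → N) (p : R3) : R3 →L[ℝ] TangentSpace (𝓡 2) (φ p) :=
  mfderiv 𝓘(ℝ, R3) (𝓡 2) φ p

/-- The tangent vector `u` at `p` is vertical: it is tangent to the fibre of `φ` through `p`. -/
def IsVertical (φ : R3 → N) (p u : R3) : Prop := diff φ p u = 0

/-- The tangent vector `u` at `p` is horizontal: it is orthogonal, for the BCV metric, to all
vertical vectors at `p`. -/
def IsHorizontal (m l : ℝ) (φ : R3 → N) (p u : R3) : Prop :=
  ∀ w : R3, IsVertical φ p w → metric m l p u w = 0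

variable [IsManifold (𝓡 2) ∞ N] [Bundle.RiemannianBundle (fun y : N ↦ TangentSpace (𝓡 2) y)]

/-- `φ`, restricted to the open set `Ω` with the BCV metric, is a Riemannian submersion into the
Riemannian surface `N`: a smooth submersion whose differential preserves inner products of
horizontal vectors. The values of `φ` outside `Ω` play no role. -/
structure IsRiemannianSubmersionOn (m l : ℝ) (φ : R3 → N) (Ω : Set R3) : Prop where
  smooth : ContMDiffOn 𝓘(ℝ, R3) (𝓡 2) ∞ φ Ω
  submersion : ∀ p ∈ Ω, Function.Surjective (diff φ p)
  isometry : ∀ p ∈ Ω, ∀ u v : R3, IsHorizontal m l φ p u → IsHorizontal m l φ p v →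
    inner ℝ (diff φ p u) (diff φ p v) = metric m l p u v

/-- `(e₁, e₂, e₃)` is a smooth orthonormal frame of the BCV metric on `U`. -/
structure IsOrthonormalFrameOn (m l : ℝ) (e₁ e₂ e₃ : R3 → R3) (U : Set R3) : Prop where
  smooth₁ : ContDiffOn ℝ ∞ e₁ U
  smooth₂ : ContDiffOn ℝ ∞ e₂ U
  smooth₃ : ContDiffOn ℝ ∞ e₃ U
  norm₁ : ∀ q ∈ U, metric m l q (e₁ q) (e₁ q) = 1
  norm₂ : ∀ q ∈ U, metric m l q (e₂ q) (e₂ q) = 1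
  norm₃ : ∀ q ∈ U, metric m l q (e₃ q) (e₃ q) = 1
  orth₁₂ : ∀ q ∈ U, metric m l q (e₁ q) (e₂ q) = 0
  orth₁₃ : ∀ q ∈ U, metric m l q (e₁ q) (e₃ q) = 0
  orth₂₃ : ∀ q ∈ U, metric m l q (e₂ q) (e₃ q) = 0

/-- `(η₁, η₂)` is a smooth orthonormal frame of the Riemannian surface `N` on `V`. -/
structure IsBaseFrameOn (η₁ η₂ : (y : N) → TangentSpace (𝓡 2) y) (V : Set N) : Prop where
  smooth₁ : ContMDiffOn (𝓡 2) (𝓡 2).tangent ∞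
    (fun y ↦ (⟨y, η₁ y⟩ : TangentBundle (𝓡 2) N)) V
  smooth₂ : ContMDiffOn (𝓡 2) (𝓡 2).tangent ∞
    (fun y ↦ (⟨y, η₂ y⟩ : TangentBundle (𝓡 2) N)) V
  norm₁ : ∀ y ∈ V, inner ℝ (η₁ y) (η₁ y) = 1
  norm₂ : ∀ y ∈ V, inner ℝ (η₂ y) (η₂ y) = 1
  orth₁₂ : ∀ y ∈ V, inner ℝ (η₁ y) (η₂ y) = 0

/-- `(e₁, e₂, e₃)` is an orthonormal frame on `U` adapted to `φ`, with `e₃` vertical: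
`e₁` and `e₂` are horizontal (being orthogonal to `e₃`) and basic, i.e. `φ`-related to a
local orthonormal frame of the base. -/
structure IsAdaptedFrameOn (m l : ℝ) (φ : R3 → N) (e₁ e₂ e₃ : R3 → R3) (U : Set R3) : Prop where
  frame : IsOrthonormalFrameOn m l e₁ e₂ e₃ U
  vertical : ∀ q ∈ U, IsVertical φ q (e₃ q)
  basic : ∃ (V : Set N) (η₁ η₂ : (y : N) → TangentSpace (𝓡 2) y),
    IsOpen V ∧ Set.MapsTo φ U V ∧ IsBaseFrameOn η₁ η₂ V ∧
      ∀ q ∈ U, diff φ q (e₁ q) = η₁ (φ q) ∧ diff φ q (e₂ q) = η₂ (φ q)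

end Submersion

end BCV

/-!
Write the unit vertical field as `e₃ = s (p E₁ + q E₂) + c E₃` with `p² + q² = s² + c² = 1`.
The horizontal unit vectors without `E₃`-component are, up to sign, `e = p E₂ - q E₁` wherever
`s ≠ 0`. So the theorem says that `e` is automatically basic, that is, that `[e₃, e]` is vertical.
Where `E₃` is vertical (`s = 0`) there is nothing to prove: every horizontal vector is then a
combination of `E₁` and `E₂`, and any frame of the base lifts.

Let `X = p E₁ + q E₂`, so that `(X, e, E₃)` is the frame `(E₁, E₂, E₃)` rotated about `E₃`. Let `f`
be the rate of this rotation along `E₃` and `v` its covariant version along `X`, so that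
`[X, E₃] = -f e` and `[e, E₃] = f X`. The metric of the base is constant along the fibres, and this
gives three first order equations for `p, q, s, c` (`RotatedFrame.isometry_conditions`). They
identify the component of `[e₃, e]` along the second horizontal vector with `±f`, so that the
claim becomes `f = 0`.

The curvature of the BCV space provides further equations for `f`, `v` and `y = c / s`, and these
are collected in `FibreSystem`. The algebraic core is `FibreSystem.f_eq_zero`: an overdetermined
system of this kind, with `R = 4 m - l² ≠ 0`, forces `f = 0`. Indeed, let `r = X y` and replace
`f, v` by `S, a` with `f = S + τ + y a`, `v = a - y (S - τ)`, `τ = l / 2`. For the fields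
`U = y X - E₃`, which kills `y`, and `T = X + y E₃`, the commutators of `e`, `U` and `T` express all
derivatives of `y, S, a`, and then give a polynomial relation `P(y, S, a) = 0` wherever `r ≠ 0`
(`FibreSystem.r_mul_R_mul_P`). Applying `U` produces a second one. Moreover
`q = 3 S² + R y² / (1 + y²)` is constant along `T`. In terms of `S`, `q` and `b = y a` the two
relations become one quadratic and one linear equation for `b`. Eliminating `b` leaves a polynomial
of degree 18 in `S` whose coefficients are constant along `T` and whose leading coefficient is a
nonzero number. Differentiating it 18 times along `T` forces `T S = 0`, hence `r = 0`, and then a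
few more derivatives give `f = 0`.

As `f` is not known to vanish identically or nowhere, all of this is done without division in a
reduced commutative `ℝ`-algebra with derivations, where "wherever `r ≠ 0`" turns into a factor `r`.
The result is then applied to the algebra `smoothFunctions W` of an open set
(`BCV.fderiv_fderiv_eq_zero`).

It remains to pass from "constant along the fibres" to "pulled back from the base". This is
`ContDiffOn.exists_local_section`, which straightens the submersion by the inverse function
theorem. With it, `BCV.IsCoordinateSubmersion.hasAdaptedFrameNear_of_not_vertical` proves the
theorem in a chart of the base.
-/

set_option linter.unusedSimpArgs false

/-! ### Derivations satisfying the structure equations -/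

theorem Derivation.map_ofNat_eq_zero {R A : Type*} [CommRing R] [CommRing A] [Algebra R A]
    (D : Derivation R A A) (n : ℕ) [n.AtLeastTwo] : D (no_index (OfNat.ofNat n : A)) = 0 :=
  D.map_natCast n

/-- The structure equations satisfied by the frame `(X, e, Z)`, `Z = E₃`, of the BCV space adapted
to a Riemannian submersion whose vertical field is proportional to `X + y Z`. The space has bundle
curvature `t` and base curvature `κ`; `v` and `f` are connection coefficients. The field `g` is the
inverse of `1 + y²`. -/
structure FibreSystem (A : Type*) [CommRing A] [Algebra ℝ A] (t κ : ℝ) where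
  e : Derivation ℝ A A
  X : Derivation ℝ A A
  Z : Derivation ℝ A A
  y : A
  v : A
  f : A
  g : A
  g_mul : g * (1 + y ^ 2) = 1
  bracket_Xe : ∀ h, X (e h) - e (X h) = -v * X h + 2 * algebraMap ℝ A t * Z h
  bracket_XZ : ∀ h, X (Z h) - Z (X h) = -f * e h
  bracket_eZ : ∀ h, e (Z h) - Z (e h) = f * X h
  e_y : e y = y * v - f + 2 * algebraMap ℝ A t
  Z_y : Z y = y * X y
  e_v : e v = v ^ 2 - 2 * algebraMap ℝ A t * f + algebraMap ℝ A κ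
  e_f : e f = f * v
  X_f : X f = Z v

namespace FibreSystem

variable {A : Type*} [CommRing A] [Algebra ℝ A] {t κ : ℝ} (Q : FibreSystem A t κ)

/-- The unit `1 + y²`. -/
def n : A := 1 + Q.y ^ 2
/-- The constant `κ - 4 t²`, which is `4 m - l²` for the BCV space. It vanishes exactly
when the curvature is constant. -/
def R (_ : FibreSystem A t κ) : A := algebraMap ℝ A κ - 4 * algebraMap ℝ A t ^ 2
/-- The bundle curvature `t`, as an element of the algebra. -/
def τ (_ : FibreSystem A t κ) : A := algebraMap ℝ A t
/-- The derivative of `y` along `X`. -/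
def r : A := Q.X Q.y
/-- With `a`, a change of variables in the `(f, v)`-plane, inverted in `f_eq` and `v_eq`, in which
the commutators of `e`, `U` and `T` take a simple form. -/
def S : A := Q.g * (Q.f - Q.y * Q.v - Q.τ + Q.τ * Q.y ^ 2)
/-- The second of the two variables that replace `(f, v)`; see `S`. -/
def a : A := Q.g * (Q.v + Q.y * Q.f - 2 * Q.τ * Q.y)
/-- The combination of `X` and `Z` that kills `y`. -/
def U : Derivation ℝ A A := Q.y • Q.X - Q.Z
/-- The direction `X + y Z`, proportional to the vertical field `s X + c Z` with `y = c / s`. -/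
def T : Derivation ℝ A A := Q.X + Q.y • Q.Z

theorem U_apply (h : A) : Q.U h = Q.y * Q.X h - Q.Z h := by simp [U]
theorem T_apply (h : A) : Q.T h = Q.X h + Q.y * Q.Z h := by simp [T]

theorem isUnit_n : IsUnit Q.n := IsUnit.of_mul_eq_one Q.g (by rw [mul_comm]; exact Q.g_mul)

theorem f_eq : Q.f = Q.S + Q.τ + Q.y * Q.a := by
  simp only [S, a]
  linear_combination (Q.τ - Q.f) * Q.g_mul

theorem v_eq : Q.v = Q.a - Q.y * (Q.S - Q.τ) := by
  simp only [S, a]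
  linear_combination (-Q.τ * Q.y - Q.v) * Q.g_mul + 2 * Q.τ * Q.y * Q.g_mul

theorem map_τ (D : Derivation ℝ A A) : D Q.τ = 0 := D.map_algebraMap t
theorem map_R (D : Derivation ℝ A A) : D Q.R = 0 := by
  have := Q.map_τ D
  simp only [τ] at this
  simp [R, Derivation.leibniz_pow, Derivation.map_ofNat_eq_zero]

theorem e_y' : Q.e Q.y = -(Q.S - Q.τ) * Q.n := by
  have h := Q.e_y
  rw [Q.f_eq, Q.v_eq] at h
  rw [h, n, τ]; ring

theorem U_y : Q.U Q.y = 0 := by rw [U_apply, Q.Z_y]; ring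
theorem T_y : Q.T Q.y = Q.n * Q.r := by rw [T_apply, Q.Z_y, n, r]; ring

theorem map_n (D : Derivation ℝ A A) : D Q.n = 2 * Q.y * D Q.y := by
  simp [n, Derivation.leibniz_pow]; ring

theorem bracket_eU (h : A) :
    Q.e (Q.U h) - Q.U (Q.e h) = -(2 * Q.y * (Q.S - Q.τ)) * Q.U h - 2 * Q.S * Q.T h := by
  have h1 := Q.bracket_Xe h
  have h2 := Q.bracket_eZ h
  have h3 := Q.e_y'
  have h4 := Q.f_eq
  have h5 := Q.v_eq
  simp only [U_apply, T_apply, map_sub, Derivation.leibniz, smul_eq_mul]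
  rw [h3]
  rw [h5] at h1
  rw [h4] at h2
  simp only [n, τ] at *
  linear_combination (-Q.y) * h1 - h2

theorem bracket_eT (h : A) :
    Q.e (Q.T h) - Q.T (Q.e h) = Q.f * Q.U h + (Q.a - Q.y * (Q.S - Q.τ)) * Q.T h := by
  have h1 := Q.bracket_Xe h
  have h2 := Q.bracket_eZ h
  have h3 := Q.e_y'
  have h4 := Q.f_eq
  have h5 := Q.v_eq
  simp only [U_apply, T_apply, map_add, Derivation.leibniz, smul_eq_mul]
  rw [h3]
  rw [h5] at h1
  rw [h4] at h2 ⊢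
  simp only [n, τ] at *
  linear_combination -h1 + Q.y * h2

theorem n_mul_e_S : Q.n * Q.e Q.S = 2 * Q.n * Q.S * Q.a - Q.R * Q.y := by
  have h1 := Q.e_v
  have h2 := Q.e_f
  have h3 := Q.e_y'
  rw [Q.f_eq] at h1 h2
  rw [Q.v_eq] at h1 h2
  simp only [map_add, map_sub, Derivation.leibniz, smul_eq_mul, Q.map_τ] at h1 h2
  rw [h3] at h1 h2
  simp only [n, τ, R] at *
  linear_combination h2 - Q.y * h1

theorem n_mul_e_a : Q.n * Q.e Q.a = Q.n * (Q.a ^ 2 - Q.S ^ 2 + Q.τ ^ 2) + Q.R := by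
  have h1 := Q.e_v
  have h2 := Q.e_f
  have h3 := Q.e_y'
  rw [Q.f_eq] at h1 h2
  rw [Q.v_eq] at h1 h2
  simp only [map_add, map_sub, Derivation.leibniz, smul_eq_mul, Q.map_τ] at h1 h2
  rw [h3] at h1 h2
  simp only [n, τ, R] at *
  linear_combination Q.y * h2 + h1

theorem U_S : Q.U Q.S = -2 * Q.r * Q.S := by
  have h := Q.bracket_eU Q.y
  rw [Q.U_y, Q.e_y', Q.T_y] at h
  simp only [map_zero, map_sub, map_neg, Derivation.leibniz, smul_eq_mul, Q.map_n, Q.U_y,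
    Q.map_τ] at h
  refine Q.isUnit_n.mul_left_cancel ?_
  linear_combination h

theorem e_r : Q.e Q.r = (Q.a - Q.y * (Q.S - Q.τ)) * Q.r - Q.T Q.S := by
  have h := Q.bracket_eT Q.y
  rw [Q.U_y, Q.e_y', Q.T_y] at h
  simp only [map_sub, map_neg, Derivation.leibniz, smul_eq_mul, Q.map_n, Q.e_y', Q.T_y,
    Q.map_τ] at h
  refine Q.isUnit_n.mul_left_cancel ?_
  linear_combination h

theorem U_a : Q.U Q.a = -Q.r * Q.a - Q.T Q.S - (Q.S - Q.τ) * Q.y * Q.r := by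
  have h := Q.X_f
  have hz := Q.Z_y
  rw [Q.f_eq, Q.v_eq] at h
  simp only [map_add, map_sub, Derivation.leibniz, smul_eq_mul, Q.map_τ] at h
  rw [hz] at h
  rw [U_apply, T_apply, r]
  linear_combination h

/-- Comes from evaluating the commutator `[e, U]` on `S`. -/
theorem T_S : 3 * Q.n * Q.S * Q.T Q.S = -Q.R * Q.r * Q.y := by
  have h := Q.bracket_eU Q.S
  have h2 := congrArg Q.U Q.n_mul_e_S
  rw [Q.U_S] at h
  simp only [map_sub, map_neg, Derivation.leibniz, smul_eq_mul, Q.map_n, Q.U_y, Q.map_R,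
    Q.U_S, Q.U_a, Q.e_r, Derivation.map_ofNat_eq_zero] at h h2
  have h3 : IsUnit (2 : A) := by
    have := (IsUnit.mk0 (2 : ℝ) two_ne_zero).map (algebraMap ℝ A)
    rwa [map_ofNat] at this
  refine h3.mul_left_cancel ?_
  linear_combination Q.n * h + h2 + 2 * Q.r * Q.n_mul_e_S

/-- The derivative of `a` along `T`, up to the factor `-r / (18 n² S³)`; see `T_a`. -/
def N : A := Q.R * (Q.y ^ 2 - 1) * Q.n * (12 * Q.S ^ 2 - 3 * Q.S * Q.τ) + 4 * Q.R ^ 2 * Q.y ^ 2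
  - 12 * Q.R * Q.y * Q.n * Q.S * Q.a - 18 * Q.n ^ 2 * Q.S ^ 3 * (Q.S + Q.τ)
  - 18 * Q.n ^ 2 * Q.S ^ 3 * (Q.y * Q.a)

/-- Comes from evaluating the commutator `[e, T]` on `S`. -/
theorem T_a : 18 * Q.n ^ 2 * Q.S ^ 3 * Q.T Q.a = -Q.r * Q.N := by
  have h := Q.bracket_eT Q.S
  have h2 := congrArg Q.e Q.T_S
  have h3 := congrArg Q.T Q.n_mul_e_S
  simp only [map_sub, map_neg, Derivation.leibniz, smul_eq_mul, Q.map_n, Q.T_y, Q.map_R,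
    Q.U_S, Q.e_r, Q.e_y', Derivation.map_ofNat_eq_zero] at h h2 h3
  rw [Q.f_eq] at h
  linear_combination (norm := (simp only [N, n]; ring))
    (-3 * Q.S) * (3 * Q.n ^ 2 * Q.S * h - Q.n * h2 + 3 * Q.n * Q.S * h3
    + (3 * Q.n * Q.T Q.S - 6 * Q.S * Q.y * Q.n * Q.r) * Q.n_mul_e_S)
    + (Q.n * Q.S * (-15 * Q.a + 9 * Q.y * (Q.S - Q.τ)) + 4 * Q.R * Q.y) * Q.T_S

/-- The polynomial in `y`, `S`, `a` that vanishes wherever `r` does not. -/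
def P : A := Q.y * (Q.n ^ 2 * (-180 * Q.S ^ 4 + 180 * Q.S ^ 3 * Q.τ - 72 * Q.S ^ 2 * Q.τ ^ 2
    + 72 * Q.S ^ 2 * Q.R - 45 * Q.S * Q.τ * Q.R)
    + Q.n * (-180 * Q.S ^ 2 * Q.R + 90 * Q.S * Q.τ * Q.R) + 40 * Q.y ^ 2 * Q.R ^ 2)
  + Q.a * (Q.n ^ 2 * (1 - Q.y ^ 2) * (180 * Q.S ^ 3 - 90 * Q.S ^ 2 * Q.τ)
    - 180 * Q.S * Q.y ^ 2 * Q.n * Q.R)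
  + 180 * Q.S ^ 2 * Q.y * Q.n ^ 2 * Q.a ^ 2

/-- The integrability condition of the system: evaluate the commutator `[e, T]` on `a`, where the
derivatives along `T` are known from `T_S` and `T_a`. -/
theorem r_mul_R_mul_P : Q.r * Q.R * Q.P = 0 := by
  have h := Q.bracket_eT Q.a
  have h2 := congrArg Q.e Q.T_a
  have h3 := congrArg Q.T Q.n_mul_e_a
  simp only [N, map_add, map_sub, map_neg, Derivation.leibniz, Derivation.leibniz_pow,
    nsmul_eq_mul, smul_eq_mul, Q.map_n, Q.T_y, Q.map_R, Q.map_τ, Derivation.map_one_eq_zero,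
    Q.U_S, Q.U_a, Q.e_r, Q.e_y', Derivation.map_ofNat_eq_zero] at h h2 h3
  rw [Q.f_eq] at h
  linear_combination (norm := (simp only [P, N, n]; push_cast; ring))
    (-3 * Q.S) * (18 * Q.n ^ 3 * Q.S ^ 3 * h - Q.n * h2 + 18 * Q.n ^ 2 * Q.S ^ 3 * h3
      + (54 * Q.n ^ 2 * Q.S ^ 2 * Q.T Q.a
          + Q.r * (Q.R * (Q.y ^ 2 - 1) * Q.n * (24 * Q.S - 3 * Q.τ) - 12 * Q.R * Q.y * Q.n * Q.a
            - 18 * Q.n ^ 2 * (4 * Q.S ^ 3 + 3 * Q.S ^ 2 * Q.τ)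
            - 54 * Q.n ^ 2 * Q.S ^ 2 * (Q.y * Q.a))) * Q.n_mul_e_S
      - (36 * Q.n ^ 2 * Q.S ^ 3 * Q.y * Q.r
          + Q.r * (12 * Q.R * Q.y * Q.n * Q.S + 18 * Q.n ^ 2 * Q.S ^ 3 * Q.y)) * Q.n_mul_e_a)
    + 3 * (Q.n * Q.S * (-9 * Q.a + 5 * Q.y * (Q.S - Q.τ)) + 3 * Q.R * Q.y) * Q.T_a
    + (18 * Q.n ^ 2 * Q.S ^ 3 * (3 * Q.S + Q.τ + Q.y * Q.a) + Q.N) * Q.T_S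

end FibreSystem

/-! ### Elimination of a variable between a quadratic and a linear equation -/

namespace Elim

variable {B : Type*} [CommRing B] (S q R t : B)

/-- The expression of `R / (1 + y²)` in terms of `S` and `q = 3 S² + R y² / (1 + y²)`. -/
def w : B := 3 * S ^ 2 - q + R
/-- The constant coefficient of the quadratic equation `180 S² w b² + 6 A₁ b + A₀ = 0` for
`b = y a` that is equivalent to `P = 0`. -/
def A0 : B := 3240 * S ^ 6 - 1350 * S ^ 5 * t - 2340 * S ^ 4 * q + 216 * S ^ 4 * t ^ 2
  + 684 * S ^ 4 * R + 720 * S ^ 3 * q * t - 135 * S ^ 3 * t * R + 540 * S ^ 2 * q ^ 2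
  - 72 * S ^ 2 * q * t ^ 2 - 348 * S ^ 2 * q * R - 90 * S * q ^ 2 * t + 45 * S * q * t * R
  - 40 * q ^ 3 + 40 * q ^ 2 * R
/-- The linear coefficient, up to the factor `6`, of the quadratic equation for `b`; see `A0`. -/
def A1 : B := 450 * S ^ 5 - 90 * S ^ 4 * t - 240 * S ^ 3 * q + 120 * S ^ 3 * R
  + 30 * S ^ 2 * q * t - 15 * S ^ 2 * t * R + 30 * S * q ^ 2 - 30 * S * q * R
/-- The linear coefficient, up to the factor `w`, of the equation `w L₁ b + L₀ = 0` obtained by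
differentiating the quadratic equation for `b` along `U`. -/
def L1 : B := -630 * S ^ 5 + 270 * S ^ 4 * t + 420 * S ^ 3 * q - 180 * S ^ 3 * R
  - 90 * S ^ 2 * q * t + 15 * S ^ 2 * t * R - 70 * S * q ^ 2 + 70 * S * q * R
/-- The constant coefficient of the linear equation for `b`; see `L1`. -/
def L0 : B := -4320 * S ^ 8 + 2970 * S ^ 7 * t + 5130 * S ^ 6 * q - 486 * S ^ 6 * t ^ 2
  - 2394 * S ^ 6 * R - 2700 * S ^ 5 * q * t + 1080 * S ^ 5 * t * R - 2250 * S ^ 4 * q ^ 2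
  + 324 * S ^ 4 * q * t ^ 2 + 2166 * S ^ 4 * q * R - 117 * S ^ 4 * t ^ 2 * R
  - 348 * S ^ 4 * R ^ 2 + 810 * S ^ 3 * q ^ 2 * t - 675 * S ^ 3 * q * t * R
  + 75 * S ^ 3 * t * R ^ 2 + 430 * S ^ 2 * q ^ 3 - 54 * S ^ 2 * q ^ 2 * t ^ 2
  - 636 * S ^ 2 * q ^ 2 * R + 39 * S ^ 2 * q * t ^ 2 * R + 206 * S ^ 2 * q * R ^ 2
  - 80 * S * q ^ 3 * t + 105 * S * q ^ 2 * t * R - 25 * S * q * t * R ^ 2 - 30 * q ^ 4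
  + 60 * q ^ 3 * R - 30 * q ^ 2 * R ^ 2
/-- The resultant of the quadratic and the linear equation for `b`, up to a factor `w`. -/
def res : B := 180 * S ^ 2 * L0 S q R t ^ 2 - 6 * A1 S q R t * L0 S q R t * L1 S q R t
  + A0 S q R t * w S q R * L1 S q R t ^ 2

open Polynomial in
theorem coeff_mul_of_le {p p' : B[X]} {m n : ℕ} {x x' : B} (h : p.natDegree ≤ m ∧ p.coeff m = x)
    (h' : p'.natDegree ≤ n ∧ p'.coeff n = x') :
    (p * p').natDegree ≤ m + n ∧ (p * p').coeff (m + n) = x * x' :=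
  ⟨natDegree_mul_le_of_le h.1 h'.1, by rw [coeff_mul_add_eq_of_natDegree_le h.1 h'.1, h.2, h'.2]⟩

open Polynomial in
/-- As a polynomial in `S`, the resultant has degree 18 and a numerical leading coefficient. -/
theorem coeff_res : (res X (C q) (C R) (C t) : B[X]).coeff 18 = -131220000 := by
  have hw : (w X (C q) (C R)).natDegree ≤ 2 ∧ (w X (C q) (C R)).coeff 2 = (3 : B) := by
    unfold w
    constructor
    · compute_degree!
    · compute_degree!
  have hA0 : (A0 X (C q) (C R) (C t)).natDegree ≤ 6 ∧
      (A0 X (C q) (C R) (C t)).coeff 6 = (3240 : B) := by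
    unfold A0
    constructor
    · compute_degree!
    · compute_degree!
  have hA1 : (A1 X (C q) (C R) (C t)).natDegree ≤ 5 ∧
      (A1 X (C q) (C R) (C t)).coeff 5 = (450 : B) := by
    unfold A1
    constructor
    · compute_degree!
    · compute_degree!
  have hL1 : (L1 X (C q) (C R) (C t)).natDegree ≤ 5 ∧
      (L1 X (C q) (C R) (C t)).coeff 5 = (-630 : B) := by
    unfold L1
    constructor
    · compute_degree!
    · compute_degree!
  have hL0 : (L0 X (C q) (C R) (C t)).natDegree ≤ 8 ∧
      (L0 X (C q) (C R) (C t)).coeff 8 = (-4320 : B) := by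
    unfold L0
    constructor
    · compute_degree!
    · compute_degree!
  have hX : (180 * X ^ 2 : B[X]).natDegree ≤ 2 ∧ (180 * X ^ 2 : B[X]).coeff 2 = 180 := by
    constructor
    · compute_degree!
    · compute_degree!
  have h6 : (6 : B[X]).natDegree ≤ 0 ∧ (6 : B[X]).coeff 0 = 6 := by
    constructor
    · compute_degree!
    · compute_degree!
  have h1 := (coeff_mul_of_le hX (coeff_mul_of_le hL0 hL0)).2
  have h2 := (coeff_mul_of_le (coeff_mul_of_le (coeff_mul_of_le h6 hA1) hL0) hL1).2
  have h3 := (coeff_mul_of_le (coeff_mul_of_le hA0 hw) (coeff_mul_of_le hL1 hL1)).2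
  norm_num only at h1 h2 h3
  simp only [res, sq (L0 _ _ _ _), sq (L1 _ _ _ _), coeff_add, coeff_sub, h1, h2, h3]
  norm_num

theorem derivation_res {B M : Type*} [CommRing B] [Algebra ℝ B] [AddCommGroup M] [Module B M]
    [Module ℝ M] (D : Derivation ℝ B M) {S q R t : B} (hS : D S = 0) (hq : D q = 0) (hR : D R = 0)
    (ht : D t = 0) : D (res S q R t) = 0 := by
  have num (k : ℕ) [k.AtLeastTwo] : D (no_index (OfNat.ofNat k : B)) = 0 := D.map_natCast k
  simp only [res, w, A0, A1, L0, L1, map_add, map_sub, map_neg,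
    Derivation.leibniz, Derivation.leibniz_pow, hS, hq, hR, ht, num, smul_zero, add_zero, sub_zero,
    neg_zero]

theorem map_res {B B' : Type*} [CommRing B] [CommRing B'] (φ : B →+* B') (S q R t : B) :
    φ (res S q R t) = res (φ S) (φ q) (φ R) (φ t) := by
  simp only [res, w, A0, A1, L0, L1, map_add, map_sub, map_neg,
    map_mul, map_pow, map_ofNat]

end Elim

open Polynomial in
/-- Let `D` kill the coefficients of the polynomial `p`, and let `x` be a zero of `p`. If `D x` is
invertible, repeated application of `D` to `p(x) = 0` shows that all coefficients of `p` vanish.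
The element `ρ` localizes this statement: equalities hold after multiplication by `ρ`, and `D x`
is cancellable in the presence of `ρ`. -/
theorem Derivation.mul_eq_zero_of_mul_eval_eq_zero {A : Type*} [CommRing A] [Algebra ℝ A]
    (D : Derivation ℝ A A) {ρ x : A} (hρ : ∀ a, ρ * D x * a = 0 → ρ * a = 0)
    (hD : ∀ a, ρ * a = 0 → ρ * D a = 0) (n : ℕ) :
    ∀ p : A[X], p.natDegree ≤ n → (∀ i, D (p.coeff i) = 0) → ρ * p.eval x = 0 →
      ∀ i, ρ * p.coeff i = 0 := by
  induction n with
  | zero =>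
    intro p hn _ h0 i
    rw [eq_C_of_natDegree_le_zero hn] at h0 ⊢
    rw [eval_C] at h0
    rw [coeff_C]
    split_ifs
    · exact h0
    · exact mul_zero _
  | succ n ih =>
    intro p hn hp h0
    have hc : D.mapCoeffs p = 0 := by
      ext i
      rw [Derivation.mapCoeffs_apply, hp]
      rfl
    have hS : ∀ i, ρ * p.coeff (i + 1) = 0 := fun i => by
      have h1 : ρ * p.derivative.coeff i = 0 := by
        refine ih _ ((natDegree_derivative_le p).trans (by omega)) (fun i => ?_) ?_ i
        · rw [coeff_derivative]
          have : D ((i : A) + 1) = 0 := by simp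
          simp [hp, this]
        · have h2 := hD _ h0
          rw [D.apply_eval_eq x p, hc, map_zero, smul_eq_mul, zero_add] at h2
          exact hρ _ (by rw [← h2]; ring)
      rw [coeff_derivative] at h1
      have h5 : IsUnit ((i : A) + 1) := by
        have := (IsUnit.mk0 ((i : ℝ) + 1) (by positivity)).map (algebraMap ℝ A)
        simpa using this
      exact h5.mul_left_eq_zero.mp (by rw [← h1]; ring)
    intro i
    cases i with
    | succ i => exact hS i
    | zero =>
      have h2 : ρ * eval x (p - C (p.coeff 0)) = 0 := by
        rw [eval_eq_sum_range, Finset.mul_sum]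
        refine Finset.sum_eq_zero fun i _ => ?_
        cases i with
        | zero => simp
        | succ i =>
          rw [coeff_sub, coeff_C_succ, sub_zero, ← mul_assoc, hS, zero_mul]
      rw [eval_sub, eval_C, mul_sub, h0, zero_sub, neg_eq_zero] at h2
      exact h2

namespace FibreSystem

variable {A : Type*} [CommRing A] [Algebra ℝ A] {t κ : ℝ} (Q : FibreSystem A t κ)

/-- `∂P/∂S`. -/
def PS : A := Q.y * (Q.n ^ 2 * (-720 * Q.S ^ 3 + 540 * Q.S ^ 2 * Q.τ - 144 * Q.S * Q.τ ^ 2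
    + 144 * Q.S * Q.R - 45 * Q.τ * Q.R)
    + Q.n * (-360 * Q.S * Q.R + 90 * Q.τ * Q.R))
  + Q.a * (Q.n ^ 2 * (1 - Q.y ^ 2) * (540 * Q.S ^ 2 - 180 * Q.S * Q.τ)
    - 180 * Q.y ^ 2 * Q.n * Q.R)
  + 360 * Q.S * Q.y * Q.n ^ 2 * Q.a ^ 2

/-- `∂P/∂a`. -/
def Pa : A := Q.n ^ 2 * (1 - Q.y ^ 2) * (180 * Q.S ^ 3 - 90 * Q.S ^ 2 * Q.τ)
    - 180 * Q.S * Q.y ^ 2 * Q.n * Q.R + 360 * Q.S ^ 2 * Q.y * Q.n ^ 2 * Q.a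

/-- The polynomial with `3 n S U(P) = r P'`; it vanishes wherever `P` does and `r` does not. -/
def P' : A := -6 * Q.n * Q.S ^ 2 * Q.PS +
  Q.Pa * (Q.R * Q.y - 3 * Q.n * Q.S * (Q.a + (Q.S - Q.τ) * Q.y))

theorem U_P : 3 * Q.n * Q.S * Q.U Q.P = Q.r * Q.P' := by
  have h : Q.U Q.P = Q.PS * Q.U Q.S + Q.Pa * Q.U Q.a := by
    simp only [P, map_add, map_sub, map_neg, Derivation.leibniz, Derivation.leibniz_pow,
      nsmul_eq_mul, smul_eq_mul, Q.map_n, Q.U_y, Q.map_R, Q.map_τ, Derivation.map_one_eq_zero,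
      Derivation.map_ofNat_eq_zero]
    simp only [PS, Pa]
    push_cast
    ring
  rw [h, U_S, U_a, P']
  linear_combination -Q.Pa * Q.T_S

/-- A first integral along the fibres: it is killed by `T`. -/
def q : A := 3 * Q.S ^ 2 + Q.R * Q.g * Q.y ^ 2

theorem n_mul_g : Q.n * Q.g = 1 := by rw [n, mul_comm]; exact Q.g_mul

theorem T_q : Q.T Q.q = 0 := by
  have h := congrArg Q.T Q.n_mul_g
  simp only [Derivation.leibniz, smul_eq_mul, map_n, T_y, Derivation.map_one_eq_zero] at h
  refine Q.isUnit_n.mul_left_cancel ?_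
  simp only [q, map_add, Derivation.leibniz, Derivation.leibniz_pow, nsmul_eq_mul, smul_eq_mul,
    map_R, T_y, Derivation.map_ofNat_eq_zero]
  push_cast
  have h3 := Q.n_mul_g
  linear_combination (norm := (simp only [n]; ring)) 2 * Q.T_S + Q.R * Q.y ^ 2 * h
    + (2 * Q.R * Q.y * Q.r) * h3

theorem w_eq : Elim.w Q.S Q.q Q.R = Q.R * Q.g := by
  simp only [Elim.w, q]
  linear_combination -Q.R * Q.g_mul

theorem n_mul_w : Q.n * Elim.w Q.S Q.q Q.R = Q.R := by
  rw [w_eq]; linear_combination Q.R * Q.n_mul_g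

theorem y_sq_mul_w : Q.y ^ 2 * Elim.w Q.S Q.q Q.R = Q.q - 3 * Q.S ^ 2 := by
  rw [w_eq]; simp only [q]; ring

/-- The relation `P = 0` in terms of `S`, `q` and `b = y a`. -/
theorem quadratic :
    6 * Q.R ^ 2 * (30 * Q.S ^ 2 * Elim.w Q.S Q.q Q.R * (Q.y * Q.a) ^ 2
      + Elim.A1 Q.S Q.q Q.R Q.τ * (Q.y * Q.a)) + Q.R ^ 2 * Elim.A0 Q.S Q.q Q.R Q.τ
    = Q.y * Elim.w Q.S Q.q Q.R ^ 3 * Q.P := by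
  have h1 := Q.n_mul_w
  have h2 := Q.y_sq_mul_w
  set w := Elim.w Q.S Q.q Q.R with hw
  have h : Q.y * w ^ 3 * Q.P =
    (Q.y ^ 2 * w) * ((Q.n * w) ^ 2 * (-180 * Q.S ^ 4 + 180 * Q.S ^ 3 * Q.τ
      - 72 * Q.S ^ 2 * Q.τ ^ 2 + 72 * Q.S ^ 2 * Q.R - 45 * Q.S * Q.τ * Q.R)
    + (Q.n * w) * w * (-180 * Q.S ^ 2 * Q.R + 90 * Q.S * Q.τ * Q.R)
    + 40 * (Q.y ^ 2 * w) * w * Q.R ^ 2)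
  + (Q.y * Q.a) * ((Q.n * w) ^ 2 * (w - Q.y ^ 2 * w) * (180 * Q.S ^ 3 - 90 * Q.S ^ 2 * Q.τ)
    - 180 * Q.S * (Q.y ^ 2 * w) * (Q.n * w) * w * Q.R)
  + 180 * Q.S ^ 2 * (Q.n * w) ^ 2 * w * (Q.y * Q.a) ^ 2 := by
    simp only [P]; ring
  rw [h, h1, h2, hw]
  simp only [Elim.w, Elim.A0, Elim.A1]
  ring

/-- The relation `P' = 0` in terms of `S`, `q` and `b = y a`. A multiple of `P` removes the term
quadratic in `b`. -/
theorem linear :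
    18 * Q.S * Q.R ^ 3 * (Elim.w Q.S Q.q Q.R * Elim.L1 Q.S Q.q Q.R Q.τ * (Q.y * Q.a)
      + Elim.L0 Q.S Q.q Q.R Q.τ)
    = -(Elim.w Q.S Q.q Q.R ^ 5 * Q.y * Q.P')
      - 18 * Q.S * Q.R * Elim.w Q.S Q.q Q.R ^ 4 * Q.y * Q.P := by
  have h1 := Q.n_mul_w
  have h2 := Q.y_sq_mul_w
  have hP := Q.quadratic
  set w := Elim.w Q.S Q.q Q.R with hw
  have hS : Q.y * w ^ 3 * Q.PS =
    (Q.y ^ 2 * w) * ((Q.n * w) ^ 2 * (-720 * Q.S ^ 3 + 540 * Q.S ^ 2 * Q.τ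
      - 144 * Q.S * Q.τ ^ 2 + 144 * Q.S * Q.R - 45 * Q.τ * Q.R)
    + (Q.n * w) * w * (-360 * Q.S * Q.R + 90 * Q.τ * Q.R))
  + (Q.y * Q.a) * ((Q.n * w) ^ 2 * (w - Q.y ^ 2 * w) * (540 * Q.S ^ 2 - 180 * Q.S * Q.τ)
    - 180 * (Q.y ^ 2 * w) * (Q.n * w) * w * Q.R)
  + 360 * Q.S * (Q.n * w) ^ 2 * w * (Q.y * Q.a) ^ 2 := by
    simp only [PS]; ring
  have ha : w ^ 3 * Q.Pa = (Q.n * w) ^ 2 * (w - Q.y ^ 2 * w) * (180 * Q.S ^ 3 - 90 * Q.S ^ 2 * Q.τ)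
    - 180 * Q.S * (Q.y ^ 2 * w) * (Q.n * w) * w * Q.R
    + 360 * Q.S ^ 2 * (Q.n * w) ^ 2 * w * (Q.y * Q.a) := by
    simp only [Pa]; ring
  have h : w ^ 5 * Q.y * Q.P' = -6 * (Q.n * w) * w * Q.S ^ 2 * (Q.y * w ^ 3 * Q.PS)
      + (w ^ 3 * Q.Pa) * (Q.R * w * (Q.y ^ 2 * w)
        - 3 * (Q.n * w) * Q.S * (w * (Q.y * Q.a) + (Q.S - Q.τ) * (Q.y ^ 2 * w))) := by
    simp only [P']; ring
  have h' : 18 * Q.S * Q.R * w ^ 4 * Q.y * Q.P = 18 * Q.S * Q.R * w * (Q.y * w ^ 3 * Q.P) := by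
    ring
  rw [h', ← hP, h, hS, ha, h1, h2, hw]
  simp only [Elim.w, Elim.A0, Elim.A1, Elim.L0, Elim.L1]
  ring

theorem isUnit_ofNat (A : Type*) [CommRing A] [Algebra ℝ A] (k : ℕ) [k.AtLeastTwo] :
    IsUnit (OfNat.ofNat k : A) := by
  have := (IsUnit.mk0 (OfNat.ofNat k : ℝ) (NeZero.ne _)).map (algebraMap ℝ A)
  rwa [map_ofNat] at this

/-- Where `r`, `y` and `S` do not vanish, neither does `T S`, so that the resultant, a polynomial in
`S` with coefficients constant along `T`, cannot vanish. -/
theorem r_mul_y_mul_S_eq_zero [IsReduced A] (hR : IsUnit Q.R) : Q.r * Q.y * Q.S = 0 := by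
  set ρ := Q.r * Q.y * Q.S with hρ
  have hsq (a : A) (h : ρ * (ρ * a) = 0) : ρ * a = 0 :=
    pow_eq_zero_iff two_ne_zero |>.mp (by linear_combination a * h)
  have hD (D : Derivation ℝ A A) (a : A) (h : ρ * a = 0) : ρ * D a = 0 := by
    have h1 := congrArg D h
    rw [Derivation.leibniz, smul_eq_mul, smul_eq_mul, map_zero] at h1
    exact hsq _ (by linear_combination ρ * h1 - D ρ * h)
  have hrP : Q.r * Q.P = 0 :=
    hR.mul_right_eq_zero.mp (by linear_combination Q.r_mul_R_mul_P)
  have hP : ρ * Q.P = 0 := by linear_combination (Q.y * Q.S) * hrP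
  have hP' : ρ * Q.P' = 0 :=
    hsq _ (by linear_combination 3 * Q.n * Q.S * Q.y * Q.S * hD Q.U _ hP
      - ρ * Q.y * Q.S * Q.U_P)
  have h1 := Q.quadratic
  have h2 := Q.linear
  have hw : IsUnit (Elim.w Q.S Q.q Q.R) := by
    have := Q.n_mul_w
    rw [← this] at hR
    exact isUnit_of_mul_isUnit_right hR
  have h3 : ρ * (Elim.w Q.S Q.q Q.R * Elim.L1 Q.S Q.q Q.R Q.τ * (Q.y * Q.a)
      + Elim.L0 Q.S Q.q Q.R Q.τ) = 0 := by
    refine hsq _ (((isUnit_ofNat A 18).mul (hR.pow 3)).mul_right_eq_zero.mp ?_)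
    linear_combination ρ * Q.r * Q.y * h2
      - Q.r * Q.y * Elim.w Q.S Q.q Q.R ^ 5 * Q.y * hP'
      - Q.r * Q.y * 18 * Q.S * Q.R * Elim.w Q.S Q.q Q.R ^ 4 * Q.y * hP
  -- Solve the linear equation for `b` and substitute into the quadratic one.
  have h4 : ρ * Elim.res Q.S Q.q Q.R Q.τ = 0 := by
    refine ((hR.pow 2).mul hw).mul_right_eq_zero.mp ?_
    simp only [Elim.res]
    generalize Elim.w Q.S Q.q Q.R = w at *
    generalize Elim.L0 Q.S Q.q Q.R Q.τ = l0 at *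
    generalize Elim.L1 Q.S Q.q Q.R Q.τ = l1 at *
    generalize Elim.A0 Q.S Q.q Q.R Q.τ = a0 at *
    generalize Elim.A1 Q.S Q.q Q.R Q.τ = a1 at *
    linear_combination ρ * w ^ 2 * l1 ^ 2 * h1 + w ^ 2 * l1 ^ 2 * Q.y * w ^ 3 * hP
      + Q.R ^ 2 * (180 * Q.S ^ 2 * w * (l0 - w * l1 * (Q.y * Q.a)) - 6 * a1 * w * l1) * h3
  open Polynomial in
  have h5 := Q.T.mul_eq_zero_of_mul_eval_eq_zero (ρ := ρ) (x := Q.S) (fun a ha => ?_) (hD Q.T) _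
    (Elim.res Polynomial.X (C Q.q) (C Q.R) (C Q.τ)) le_rfl (fun i => ?_) ?_ 18
  · rw [Elim.coeff_res] at h5
    refine (isUnit_ofNat A 131220000).mul_right_eq_zero.mp ?_
    linear_combination -h5
  · refine hsq _ (hR.mul_right_eq_zero.mp ?_)
    linear_combination -3 * Q.n * Q.S * Q.S * ha + ρ * Q.S * a * Q.T_S
  · rw [← Derivation.mapCoeffs_apply]
    have hq : Q.T.mapCoeffs (C Q.q) = 0 := by simp [T_q]
    have hτ : Q.T.mapCoeffs (C Q.τ) = 0 := by simp [map_τ]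
    have hR : Q.T.mapCoeffs (C Q.R) = 0 := by simp [map_R]
    rw [Elim.derivation_res _ (Derivation.mapCoeffs_X _) hq hR hτ]
    rfl
  · rw [← coe_evalRingHom, Elim.map_res]
    simpa using h4

theorem r_eq_zero [IsReduced A] (hR : IsUnit Q.R) : Q.r = 0 := by
  have h := Q.r_mul_y_mul_S_eq_zero hR
  have h1 : Q.r * Q.y = 0 := by
    refine pow_eq_zero_iff (two_ne_zero) |>.mp ?_
    refine hR.mul_right_eq_zero.mp ?_
    linear_combination (Q.r * Q.y) * Q.T_S - 3 * Q.n * Q.T Q.S * h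
  have h2 := congrArg Q.T h1
  rw [Derivation.leibniz, smul_eq_mul, smul_eq_mul, T_y, map_zero] at h2
  refine pow_eq_zero_iff (three_ne_zero) |>.mp (Q.isUnit_n.mul_right_eq_zero.mp ?_)
  linear_combination Q.r * h2 - Q.T Q.r * h1

/-- The structure equations force `f = 0`, unless the curvature is constant. -/
theorem f_eq_zero [IsReduced A] (hR : IsUnit Q.R) : Q.f = 0 := by
  have hr := Q.r_eq_zero hR
  have hXy : Q.X Q.y = 0 := hr
  have hZy : Q.Z Q.y = 0 := by rw [Q.Z_y, hXy, mul_zero]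
  have h1 : Q.f * (Q.S - Q.τ) = 0 := by
    have := Q.bracket_XZ Q.y
    rw [hXy, hZy, e_y'] at this
    refine Q.isUnit_n.mul_right_eq_zero.mp ?_
    simp only [map_zero] at this
    linear_combination -this
  have hey : Q.f * Q.e Q.y = 0 := by rw [e_y']; linear_combination -Q.n * h1
  have h2 : Q.f * (2 * Q.n * Q.τ * Q.a - Q.R * Q.y) = 0 := by
    have := congrArg Q.e h1
    simp only [Derivation.leibniz, smul_eq_mul, map_sub, map_τ, map_zero, Q.e_f] at this
    linear_combination Q.n * this - Q.f * Q.n_mul_e_S - (Q.n * Q.v + 2 * Q.n * Q.a) * h1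
  have h3 : Q.f * Q.τ * (Q.n * Q.a ^ 2 + Q.R) = 0 := by
    have := congrArg Q.e h2
    simp only [Derivation.leibniz, smul_eq_mul, map_sub, map_τ, map_zero, Q.e_f, map_R, map_n,
      Derivation.map_ofNat_eq_zero] at this
    refine (isUnit_ofNat A 2).mul_right_eq_zero.mp ?_
    linear_combination this - Q.v * h2 - (4 * Q.y * Q.τ * Q.a - Q.R) * hey
      - 2 * Q.f * Q.τ * Q.n_mul_e_a + 2 * Q.τ * Q.n * (Q.S + Q.τ) * h1
  refine pow_eq_zero_iff (two_ne_zero) |>.mp (hR.mul_right_eq_zero.mp ?_)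
  have h5 := Q.f_eq
  linear_combination Q.R * Q.f * h5 + Q.R * h1 - Q.a * h2 + 2 * h3

end FibreSystem

/-! ### The rotated frame of the BCV space -/

/-- An algebra with three commuting derivations, thought of as the partial derivatives of functions
of `x`, `y`, `z`, and two elements that behave as the first two coordinates. -/
structure CoordinateAlgebra (A : Type*) [CommRing A] [Algebra ℝ A] where
  d : Fin 3 → Derivation ℝ A A
  x : A
  y : A
  comm : ∀ i j h, d i (d j h) = d j (d i h)
  d_x : d 0 x = 1 ∧ d 1 x = 0 ∧ d 2 x = 0
  d_y : d 0 y = 0 ∧ d 1 y = 1 ∧ d 2 y = 0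

namespace CoordinateAlgebra

variable {A : Type*} [CommRing A] [Algebra ℝ A] (K : CoordinateAlgebra A) (m l : ℝ)

/-- The function `F = 1 + m (x² + y²)`. -/
def F : A := 1 + algebraMap ℝ A m * (K.x ^ 2 + K.y ^ 2)

/-- The field `E₁ = F ∂/∂x - (l y / 2) ∂/∂z`. -/
noncomputable def E1 : Derivation ℝ A A := K.F m • K.d 0 - (algebraMap ℝ A (l / 2) * K.y) • K.d 2

/-- The field `E₂ = F ∂/∂y + (l x / 2) ∂/∂z`. -/
noncomputable def E2 : Derivation ℝ A A := K.F m • K.d 1 + (algebraMap ℝ A (l / 2) * K.x) • K.d 2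

/-- The field `E₃ = ∂/∂z`. -/
def E3 : Derivation ℝ A A := K.d 2

theorem bracket_E12 (h : A) : K.E1 m l (K.E2 m l h) - K.E2 m l (K.E1 m l h) =
    -(2 * algebraMap ℝ A m * K.y) * K.E1 m l h + 2 * algebraMap ℝ A m * K.x * K.E2 m l h
      + 2 * algebraMap ℝ A (l / 2) * K.E3 h := by
  obtain ⟨hx0, hx1, hx2⟩ := K.d_x
  obtain ⟨hy0, hy1, hy2⟩ := K.d_y
  simp only [E1, E2, E3, F, Derivation.add_apply, Derivation.sub_apply, Derivation.smul_apply,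
    smul_eq_mul, map_add, map_sub, Derivation.leibniz, Derivation.leibniz_pow, nsmul_eq_mul,
    Derivation.map_algebraMap, Derivation.map_one_eq_zero, hx0, hx1, hx2, hy0, hy1, hy2,
    K.comm 1 0, K.comm 2 0, K.comm 2 1]
  push_cast
  ring

theorem E1_E3 (h : A) : K.E1 m l (K.E3 h) = K.E3 (K.E1 m l h) := by
  obtain ⟨hx0, hx1, hx2⟩ := K.d_x
  obtain ⟨hy0, hy1, hy2⟩ := K.d_y
  simp only [E1, E3, F, Derivation.add_apply, Derivation.sub_apply, Derivation.smul_apply,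
    smul_eq_mul, map_add, map_sub, Derivation.leibniz, Derivation.leibniz_pow, nsmul_eq_mul,
    Derivation.map_algebraMap, Derivation.map_one_eq_zero, hx0, hx1, hx2, hy0, hy1, hy2,
    K.comm 1 0, K.comm 2 0, K.comm 2 1]
  push_cast
  ring

theorem E2_E3 (h : A) : K.E2 m l (K.E3 h) = K.E3 (K.E2 m l h) := by
  obtain ⟨hx0, hx1, hx2⟩ := K.d_x
  obtain ⟨hy0, hy1, hy2⟩ := K.d_y
  simp only [E2, E3, F, Derivation.add_apply, Derivation.sub_apply, Derivation.smul_apply,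
    smul_eq_mul, map_add, map_sub, Derivation.leibniz, Derivation.leibniz_pow, nsmul_eq_mul,
    Derivation.map_algebraMap, Derivation.map_one_eq_zero, hx0, hx1, hx2, hy0, hy1, hy2,
    K.comm 1 0, K.comm 2 0, K.comm 2 1]
  push_cast
  ring

end CoordinateAlgebra

/-- The data of a unit field `s (p E₁ + q E₂) + c E₃` in the BCV space, in which `s` has the inverse
`si`. Below, it plays the role of the vertical field of a submersion. -/
structure RotatedFrame {A : Type*} [CommRing A] [Algebra ℝ A] (K : CoordinateAlgebra A)
    (m l : ℝ) where
  p : A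
  q : A
  s : A
  c : A
  si : A
  sq_p_q : p ^ 2 + q ^ 2 = 1
  sq_s_c : s ^ 2 + c ^ 2 = 1
  s_mul : s * si = 1

namespace RotatedFrame

variable {A : Type*} [CommRing A] [Algebra ℝ A] {K : CoordinateAlgebra A} {m l : ℝ}
  (G : RotatedFrame K m l)

/-- The direction of the component of the vertical field orthogonal to `E₃`. -/
noncomputable def X : Derivation ℝ A A := G.p • K.E1 m l + G.q • K.E2 m l

/-- The horizontal unit field without `E₃`-component. -/
noncomputable def e : Derivation ℝ A A := G.p • K.E2 m l - G.q • K.E1 m l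

/-- The field `E₃`. -/
def Z (_ : RotatedFrame K m l) : Derivation ℝ A A := K.E3

/-- The second horizontal unit field. -/
noncomputable def e2 : Derivation ℝ A A := G.c • G.X - G.s • G.Z

/-- The vertical unit field. -/
noncomputable def e3 : Derivation ℝ A A := G.s • G.X + G.c • G.Z

/-- The derivative in the direction `D` of the angle from `E₁` to `X`. -/
def α (D : Derivation ℝ A A) : A := G.p * D G.q - G.q * D G.p

/-- The derivative in the direction `D` of the angle from `E₃` to the vertical field. -/
def θ (D : Derivation ℝ A A) : A := G.c * D G.s - G.s * D G.c

theorem map_p (D : Derivation ℝ A A) : D G.p = -G.q * G.α D := by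
  have h := congrArg D G.sq_p_q
  simp only [map_add, Derivation.leibniz_pow, nsmul_eq_mul, smul_eq_mul,
    Derivation.map_one_eq_zero] at h
  refine (FibreSystem.isUnit_ofNat A 2).mul_left_cancel ?_
  push_cast at h
  simp only [α]
  linear_combination G.p * h - 2 * D G.p * G.sq_p_q

theorem map_q (D : Derivation ℝ A A) : D G.q = G.p * G.α D := by
  have h := congrArg D G.sq_p_q
  simp only [map_add, Derivation.leibniz_pow, nsmul_eq_mul, smul_eq_mul,
    Derivation.map_one_eq_zero] at h
  refine (FibreSystem.isUnit_ofNat A 2).mul_left_cancel ?_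
  push_cast at h
  simp only [α]
  linear_combination G.q * h - 2 * D G.q * G.sq_p_q

theorem map_s (D : Derivation ℝ A A) : D G.s = G.c * G.θ D := by
  have h := congrArg D G.sq_s_c
  simp only [map_add, Derivation.leibniz_pow, nsmul_eq_mul, smul_eq_mul,
    Derivation.map_one_eq_zero] at h
  refine (FibreSystem.isUnit_ofNat A 2).mul_left_cancel ?_
  push_cast at h
  simp only [θ]
  linear_combination G.s * h - 2 * D G.s * G.sq_s_c

theorem map_c (D : Derivation ℝ A A) : D G.c = -G.s * G.θ D := by
  have h := congrArg D G.sq_s_c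
  simp only [map_add, Derivation.leibniz_pow, nsmul_eq_mul, smul_eq_mul,
    Derivation.map_one_eq_zero] at h
  refine (FibreSystem.isUnit_ofNat A 2).mul_left_cancel ?_
  push_cast at h
  simp only [θ]
  linear_combination G.c * h - 2 * D G.c * G.sq_s_c

/-- The rotation form `α` along `E₁`, corrected by the connection form of the surface with metric
`(dx² + dy²) / F²`. -/
noncomputable def ω1 : A := G.α (K.E1 m l) + 2 * algebraMap ℝ A m * K.y

/-- The rotation form `α` along `E₂`, corrected as in `ω1`. -/
noncomputable def ω2 : A := G.α (K.E2 m l) - 2 * algebraMap ℝ A m * K.x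

/-- The rotation of `X` along `E₃`. -/
noncomputable def f : A := G.α K.E3

/-- The covariant rotation of `X` along `X`. -/
noncomputable def v : A := G.p * G.ω1 + G.q * G.ω2

/-- The covariant rotation of `X` along `e`. -/
noncomputable def ωe : A := G.p * G.ω2 - G.q * G.ω1

/-- The bundle curvature `l / 2`. -/
noncomputable def τ (_ : RotatedFrame K m l) : A := algebraMap ℝ A (l / 2)

theorem map_τ (D : Derivation ℝ A A) : D G.τ = 0 := D.map_algebraMap _

theorem X_apply (h : A) : G.X h = G.p * K.E1 m l h + G.q * K.E2 m l h := by simp [X]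
theorem e_apply (h : A) : G.e h = G.p * K.E2 m l h - G.q * K.E1 m l h := by simp [e]
theorem Z_apply (h : A) : G.Z h = K.E3 h := rfl
theorem e2_apply (h : A) : G.e2 h = G.c * G.X h - G.s * G.Z h := by simp [e2]
theorem e3_apply (h : A) : G.e3 h = G.s * G.X h + G.c * G.Z h := by simp [e3]

theorem α_X : G.α G.X = G.p * G.α (K.E1 m l) + G.q * G.α (K.E2 m l) := by
  simp only [α, X_apply]; ring

theorem α_e : G.α G.e = G.p * G.α (K.E2 m l) - G.q * G.α (K.E1 m l) := by
  simp only [α, e_apply]; ring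

theorem α_Z : G.α G.Z = G.α K.E3 := rfl

theorem bracket_Xe (h : A) : G.X (G.e h) - G.e (G.X h) =
    -G.v * G.X h - G.ωe * G.e h + 2 * G.τ * G.Z h := by
  have h1 := K.bracket_E12 m l h
  simp only [X_apply, e_apply, Z_apply, map_add, map_sub, Derivation.leibniz, smul_eq_mul,
    map_p, map_q, α_X, α_e, α_Z, v, ωe, ω1, ω2, τ]
  linear_combination (G.p ^ 2 + G.q ^ 2) * h1 + 2 * algebraMap ℝ A (l / 2) * K.E3 h * G.sq_p_q

theorem bracket_XZ (h : A) : G.X (G.Z h) - G.Z (G.X h) = -G.f * G.e h := by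
  simp only [X_apply, e_apply, Z_apply, map_add, map_sub, Derivation.leibniz, smul_eq_mul,
    map_p, map_q, α_X, α_e, α_Z, f, K.E1_E3, K.E2_E3]
  ring

theorem bracket_eZ (h : A) : G.e (G.Z h) - G.Z (G.e h) = G.f * G.X h := by
  simp only [X_apply, e_apply, Z_apply, map_add, map_sub, Derivation.leibniz, smul_eq_mul,
    map_p, map_q, α_X, α_e, α_Z, f, K.E1_E3, K.E2_E3]
  ring

/-- The curvature component in the plane of `E₁`, `E₂`. -/
theorem curvature_12 : K.E1 m l G.ω2 - K.E2 m l G.ω1 =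
    -(2 * algebraMap ℝ A m * K.y) * G.ω1 + 2 * algebraMap ℝ A m * K.x * G.ω2
      + 2 * G.τ * (G.f - G.τ) - 4 * algebraMap ℝ A m + 2 * G.τ ^ 2 := by
  obtain ⟨hx0, hx1, hx2⟩ := K.d_x
  obtain ⟨hy0, hy1, hy2⟩ := K.d_y
  have h1 := K.bracket_E12 m l G.p
  have h2 := K.bracket_E12 m l G.q
  have hx : K.E1 m l K.x = K.F m := by simp [CoordinateAlgebra.E1, hx0, hx2]
  have hy : K.E2 m l K.y = K.F m := by simp [CoordinateAlgebra.E2, hy1, hy2]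
  simp only [ω1, ω2, α, f, map_add, map_sub, Derivation.leibniz, smul_eq_mul, hx, hy,
    Derivation.map_algebraMap, Derivation.map_ofNat_eq_zero, τ]
  have hF : K.F m = 1 + algebraMap ℝ A m * (K.x ^ 2 + K.y ^ 2) := rfl
  rw [hF]
  have h3 := G.map_p (K.E1 m l)
  have h4 := G.map_p (K.E2 m l)
  have h5 := G.map_q (K.E1 m l)
  have h6 := G.map_q (K.E2 m l)
  generalize G.α (K.E1 m l) = a1 at *
  generalize G.α (K.E2 m l) = a2 at *
  linear_combination G.p * h2 - G.q * h1 + 2 * K.E2 m l G.q * h3 - 2 * K.E2 m l G.p * h5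
    - 2 * G.q * a1 * h6 - 2 * G.p * a1 * h4

theorem curvature_13 : K.E1 m l G.f = K.E3 G.ω1 := by
  obtain ⟨hx0, hx1, hx2⟩ := K.d_x
  obtain ⟨hy0, hy1, hy2⟩ := K.d_y
  have h1 := K.E1_E3 m l G.p
  have h2 := K.E1_E3 m l G.q
  have hy : K.E3 K.y = 0 := hy2
  have h3 : K.E3 G.q * K.E1 m l G.p = K.E3 G.p * K.E1 m l G.q := by
    rw [map_p, map_q, map_p, map_q]; ring
  simp only [ω1, f, α, map_add, map_sub, Derivation.leibniz, smul_eq_mul, hy,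
    Derivation.map_algebraMap, Derivation.map_ofNat_eq_zero]
  linear_combination G.p * h2 - G.q * h1 + 2 * h3

theorem curvature_23 : K.E2 m l G.f = K.E3 G.ω2 := by
  obtain ⟨hx0, hx1, hx2⟩ := K.d_x
  obtain ⟨hy0, hy1, hy2⟩ := K.d_y
  have h1 := K.E2_E3 m l G.p
  have h2 := K.E2_E3 m l G.q
  have hy : K.E3 K.x = 0 := hx2
  have h3 : K.E3 G.q * K.E2 m l G.p = K.E3 G.p * K.E2 m l G.q := by
    rw [map_p, map_q, map_p, map_q]; ring
  simp only [ω2, f, α, map_add, map_sub, Derivation.leibniz, smul_eq_mul, hy,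
    Derivation.map_algebraMap, Derivation.map_ofNat_eq_zero]
  linear_combination G.p * h2 - G.q * h1 + 2 * h3

theorem e_v (h : G.ωe = 0) :
    G.e G.v = G.v ^ 2 - 2 * G.τ * G.f + 4 * algebraMap ℝ A m := by
  have h1 := congrArg G.X h
  have h2 := G.curvature_12
  rw [map_zero] at h1
  simp only [X_apply, e_apply, v, ωe, map_add, map_sub, Derivation.leibniz, smul_eq_mul, map_p,
    map_q] at h h1 ⊢
  rw [α_X] at h1
  rw [α_e]
  have h5 : G.α (K.E1 m l) = G.ω1 - 2 * algebraMap ℝ A m * K.y := by rw [ω1]; ring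
  have h6 : G.α (K.E2 m l) = G.ω2 + 2 * algebraMap ℝ A m * K.x := by rw [ω2]; ring
  rw [h5, h6] at h1 ⊢
  linear_combination h1 - (G.p ^ 2 + G.q ^ 2) * h2
    - (2 * G.τ * G.f - 4 * algebraMap ℝ A m) * G.sq_p_q + (G.p * G.ω2 - G.q * G.ω1) * h

theorem e_f (h : G.ωe = 0) : G.e G.f = G.f * G.v := by
  have h1 := congrArg G.Z h
  have h2 := G.curvature_13
  have h3 := G.curvature_23
  rw [map_zero] at h1
  simp only [e_apply, Z_apply, v, ωe, map_add, map_sub, Derivation.leibniz, smul_eq_mul, map_p,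
    map_q, α_Z] at h1 ⊢
  rw [h2, h3]
  simp only [f]
  linear_combination h1

theorem X_f (h : G.ωe = 0) : G.X G.f = G.Z G.v := by
  have h2 := G.curvature_13
  have h3 := G.curvature_23
  simp only [X_apply, Z_apply, v, ωe, map_add, map_sub, Derivation.leibniz, smul_eq_mul, map_p,
    map_q, α_Z] at h ⊢
  rw [h2, h3]
  linear_combination -G.α K.E3 * h

/-- The cotangent of the angle from `E₃` to the vertical field. -/
def y : A := G.c * G.si

theorem s_sq_mul_map_y (D : Derivation ℝ A A) : G.s ^ 2 * D G.y = -G.θ D := by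
  have h := congrArg D G.s_mul
  have h1 := G.map_s D
  have h2 := G.map_c D
  simp only [y, Derivation.leibniz, smul_eq_mul, Derivation.map_one_eq_zero] at h ⊢
  linear_combination G.s * G.c * h + G.s ^ 2 * G.si * h2 - G.c * G.s * G.si * h1
    - (G.c^2 + G.s ^ 2) * G.θ D * G.s_mul - G.θ D * G.sq_s_c

theorem bracket_e_e3 (h : A) : G.e (G.e3 h) - G.e3 (G.e h) =
    G.s * G.ωe * G.e h
    + (G.θ G.e + G.c * G.s * G.v + 2 * G.τ * G.s ^ 2 + G.c ^ 2 * G.f) * G.e2 h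
    + (G.s ^ 2 * G.v - 2 * G.τ * G.s * G.c + G.c * G.s * G.f) * G.e3 h := by
  have h1 := G.bracket_Xe h
  have h2 := G.bracket_eZ h
  have h3 := G.sq_s_c
  simp only [e2_apply, e3_apply, map_add, Derivation.leibniz, smul_eq_mul, map_s, map_c]
  linear_combination -G.s * h1 + G.c * h2
    + (-G.s * G.v * G.X h + 2 * G.s * G.τ * G.Z h - G.c * G.f * G.X h) * h3

theorem bracket_e2_e3 (h : A) : G.e2 (G.e3 h) - G.e3 (G.e2 h) =
    -G.f * G.e h + G.θ G.e2 * G.e2 h + G.θ G.e3 * G.e3 h := by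
  have h1 := G.bracket_XZ h
  have h3 := G.sq_s_c
  rw [G.e3_apply h, G.e2_apply h]
  simp only [map_add, map_sub, Derivation.leibniz, smul_eq_mul, map_s, map_c]
  rw [e2_apply, e2_apply, e3_apply, e3_apply]
  linear_combination (G.s ^ 2 + G.c ^ 2) * h1 - G.f * G.e h * h3

/-- Let `h₁`, `h₂` be constant along the fibres with independent differentials, and let the
inverse metric `(h_i, h_j) ↦ e h_i * e h_j + e₂ h_i * e₂ h_j` of the base be constant along the
fibres too. Then the derivative of the horizontal metric along the vertical field vanishes, which
is a condition on the three entries of the symmetric part of the action of `e₃` on `(e, e₂)`. -/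
theorem isometry_conditions (h1 h2 : A) (hh1 : G.e3 h1 = 0) (hh2 : G.e3 h2 = 0)
    (k11 : G.e3 (G.e h1 * G.e h1 + G.e2 h1 * G.e2 h1) = 0)
    (k12 : G.e3 (G.e h1 * G.e h2 + G.e2 h1 * G.e2 h2) = 0)
    (k22 : G.e3 (G.e h2 * G.e h2 + G.e2 h2 * G.e2 h2) = 0)
    (hΔ : IsUnit (G.e h1 * G.e2 h2 - G.e2 h1 * G.e h2)) :
    G.ωe = 0 ∧ G.θ G.e2 = 0 ∧
      G.θ G.e = G.s ^ 2 * G.f - G.c * G.s * G.v - 2 * G.τ * G.s ^ 2 := by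
  have a1 := G.bracket_e_e3 h1
  have a2 := G.bracket_e_e3 h2
  have b1 := G.bracket_e2_e3 h1
  have b2 := G.bracket_e2_e3 h2
  rw [hh1, map_zero] at a1 b1
  rw [hh2, map_zero] at a2 b2
  simp only [map_add, Derivation.leibniz, smul_eq_mul] at k11 k12 k22
  set N := G.θ G.e + G.c * G.s * G.v + 2 * G.τ * G.s ^ 2 + G.c ^ 2 * G.f with hN
  set Δ := G.e h1 * G.e2 h2 - G.e2 h1 * G.e h2 with hΔ'
  have c1 : G.e3 (G.e h1) = -(G.s * G.ωe * G.e h1) - N * G.e2 h1 := by linear_combination -a1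
  have c2 : G.e3 (G.e h2) = -(G.s * G.ωe * G.e h2) - N * G.e2 h2 := by linear_combination -a2
  have d1 : G.e3 (G.e2 h1) = G.f * G.e h1 - G.θ G.e2 * G.e2 h1 := by linear_combination -b1
  have d2 : G.e3 (G.e2 h2) = G.f * G.e h2 - G.θ G.e2 * G.e2 h2 := by linear_combination -b2
  rw [c1, d1] at k11
  rw [c1, c2, d1, d2] at k12
  rw [c2, d2] at k22
  have u2 := FibreSystem.isUnit_ofNat A 2
  have r1 : G.s * G.ωe = 0 := by
    refine (u2.mul (hΔ.pow 2)).mul_right_eq_zero.mp ?_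
    linear_combination -G.e2 h2 ^ 2 * k11 + 2 * G.e2 h1 * G.e2 h2 * k12 - G.e2 h1 ^ 2 * k22
  have r2 : G.θ G.e2 = 0 := by
    refine (u2.mul (hΔ.pow 2)).mul_right_eq_zero.mp ?_
    linear_combination -G.e h2 ^ 2 * k11 + 2 * G.e h1 * G.e h2 * k12 - G.e h1 ^ 2 * k22
  have r3 : G.f - N = 0 := by
    refine (u2.mul (hΔ.pow 2)).mul_right_eq_zero.mp ?_
    linear_combination -2 * G.e h2 * G.e2 h2 * k11
      + 2 * (G.e h1 * G.e2 h2 + G.e2 h1 * G.e h2) * k12 - 2 * G.e h1 * G.e2 h1 * k22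
  refine ⟨by linear_combination G.si * r1 - G.ωe * G.s_mul, r2, ?_⟩
  linear_combination -r3 - hN - G.f * G.sq_s_c

/-- For a Riemannian submersion the rotated frame satisfies the structure equations of
`FibreSystem`, with bundle curvature `l / 2` and base curvature `4 m`. -/
noncomputable def fibreSystem (h0 : G.ωe = 0) (h1 : G.θ G.e2 = 0)
    (h2 : G.θ G.e = G.s ^ 2 * G.f - G.c * G.s * G.v - 2 * G.τ * G.s ^ 2) :
    FibreSystem A (l / 2) (4 * m) where
  e := G.e
  X := G.X
  Z := G.Z
  y := G.y
  v := G.v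
  f := G.f
  g := G.s ^ 2
  g_mul := by
    simp only [y]
    linear_combination G.sq_s_c + G.c ^ 2 * (G.s * G.si + 1) * G.s_mul
  bracket_Xe h := by rw [G.bracket_Xe, h0, τ]; ring
  bracket_XZ := G.bracket_XZ
  bracket_eZ := G.bracket_eZ
  e_y := by
    have hs : IsUnit (G.s ^ 2) := (IsUnit.of_mul_eq_one _ G.s_mul).pow 2
    refine hs.mul_left_cancel ?_
    rw [s_sq_mul_map_y, h2, y, τ]
    linear_combination -G.s * G.c * G.v * G.s_mul
  Z_y := by
    have hs : IsUnit (G.s ^ 3) := (IsUnit.of_mul_eq_one _ G.s_mul).pow 3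
    refine hs.mul_left_cancel ?_
    have hX := G.s_sq_mul_map_y G.X
    have hZ := G.s_sq_mul_map_y G.Z
    have h3 : G.θ G.e2 = G.c * G.θ G.X - G.s * G.θ G.Z := by
      simp only [θ, e2_apply]; ring
    have hy : G.y = G.c * G.si := rfl
    rw [h3] at h1
    linear_combination G.s * hZ - G.s * G.y * hX + G.s * G.θ G.X * hy
      + G.c * G.θ G.X * G.s_mul + h1
  e_v := by rw [G.e_v h0, map_mul, map_ofNat, τ]
  e_f := G.e_f h0
  X_f := G.X_f h0

/-- The horizontal field `e` preserves the functions that are constant along the fibres. -/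
theorem e3_e_eq_zero [IsReduced A] (hml : 4 * m - l ^ 2 ≠ 0)
    (h1 h2 : A) (hh1 : G.e3 h1 = 0) (hh2 : G.e3 h2 = 0)
    (k11 : G.e3 (G.e h1 * G.e h1 + G.e2 h1 * G.e2 h1) = 0)
    (k12 : G.e3 (G.e h1 * G.e h2 + G.e2 h1 * G.e2 h2) = 0)
    (k22 : G.e3 (G.e h2 * G.e h2 + G.e2 h2 * G.e2 h2) = 0)
    (hΔ : IsUnit (G.e h1 * G.e2 h2 - G.e2 h1 * G.e h2)) (h : A) (hh : G.e3 h = 0) :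
    G.e3 (G.e h) = 0 := by
  obtain ⟨r0, r1, r2⟩ := G.isometry_conditions h1 h2 hh1 hh2 k11 k12 k22 hΔ
  have hf : G.f = 0 := (G.fibreSystem r0 r1 r2).f_eq_zero (by
    have := (IsUnit.mk0 _ hml).map (algebraMap ℝ A)
    have h4 : algebraMap ℝ A (l ^ 2) = 4 * algebraMap ℝ A (l / 2) ^ 2 := by
      rw [show l ^ 2 = 4 * (l / 2) ^ 2 by ring, map_mul, map_pow, map_ofNat]
    rw [map_sub, h4] at this
    rw [FibreSystem.R]
    exact this)
  have b := G.bracket_e_e3 h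
  rw [hh, r0, r2, hf, map_zero] at b
  linear_combination -b

end RotatedFrame

/-! ### The algebra of smooth functions on an open set -/

section SmoothFunctions

/-- The extension by zero of a real function on a subset `W`. -/
noncomputable def zeroExtension {E : Type*} {W : Set E} (f : W → ℝ) : E → ℝ :=
  Function.extend Subtype.val f 0

theorem zeroExtension_apply {E : Type*} {W : Set E} (f : W → ℝ) {q : E} (hq : q ∈ W) :
    zeroExtension f q = f ⟨q, hq⟩ :=
  Subtype.val_injective.extend_apply f 0 ⟨q, hq⟩

theorem zeroExtension_mk_eventuallyEq {E : Type*} [TopologicalSpace E] {W : Set E}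
    (hW : IsOpen W) (f : E → ℝ) {q : E} (hq : q ∈ W) :
    zeroExtension (fun q : W ↦ f q) =ᶠ[𝓝 q] f :=
  Filter.eventually_of_mem (hW.mem_nhds hq) fun _ hr ↦ zeroExtension_apply _ hr

variable {E : Type*} [NormedAddCommGroup E] [NormedSpace ℝ E]

/-- The algebra of smooth real functions on a subset `W` (open, in all uses) of a normed space.
Its elements are functions on the subtype `W`, so that equality in it means equality on `W`. -/
def smoothFunctions (W : Set E) : Subalgebra ℝ (W → ℝ) where
  carrier := {f | ContDiffOn ℝ ∞ (zeroExtension f) W}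
  mul_mem' {f g} hf hg := (ContDiffOn.mul hf hg).congr fun q hq ↦ by
    simp [zeroExtension_apply _ hq]
  add_mem' {f g} hf hg := (ContDiffOn.add hf hg).congr fun q hq ↦ by
    simp [zeroExtension_apply _ hq]
  algebraMap_mem' r := (contDiffOn_const (c := r)).congr fun q hq ↦ by
    simp [zeroExtension_apply _ hq]

namespace smoothFunctions

variable {W : Set E}

/-- The restriction to `W` of a function that is smooth on `W`. -/
def mk (f : E → ℝ) (hf : ContDiffOn ℝ ∞ f W) : smoothFunctions W :=
  ⟨fun q ↦ f q, hf.congr fun _ hq ↦ zeroExtension_apply _ hq⟩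

theorem eq_iff {f g : smoothFunctions W} : f = g ↔ ∀ q, f.1 q = g.1 q :=
  ⟨fun h _ ↦ by rw [h], fun h ↦ Subtype.ext (funext h)⟩

instance : IsReduced (smoothFunctions W) where
  eq_zero f hf := by
    obtain ⟨n, hn⟩ := hf
    refine eq_iff.mpr fun q ↦ ?_
    have := eq_iff.mp hn q
    exact eq_zero_of_pow_eq_zero this

theorem isUnit_of_ne_zero {f : smoothFunctions W} (h : ∀ q, f.1 q ≠ 0) : IsUnit f := by
  refine IsUnit.of_mul_eq_one (mk (fun q ↦ (zeroExtension f.1 q)⁻¹) (ContDiffOn.inv f.2 ?_)) ?_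
  · intro q hq
    rw [zeroExtension_apply _ hq]
    exact h _
  · refine eq_iff.mpr fun q ↦ ?_
    change f.1 q * (zeroExtension f.1 q)⁻¹ = 1
    rw [zeroExtension_apply _ q.2]
    exact mul_inv_cancel₀ (h q)

theorem contDiffOn_fderiv_apply (hW : IsOpen W) {f : E → ℝ} (hf : ContDiffOn ℝ ∞ f W) {v : E → E}
    (hv : ContDiffOn ℝ ∞ v W) : ContDiffOn ℝ ∞ (fun q ↦ fderiv ℝ f q (v q)) W :=
  (hf.fderiv_of_isOpen hW (by simp)).clm_apply hv

theorem differentiableAt (hW : IsOpen W) {f : E → ℝ} (hf : ContDiffOn ℝ ∞ f W) {q : E}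
    (hq : q ∈ W) : DifferentiableAt ℝ f q :=
  (hf.contDiffAt (hW.mem_nhds hq)).differentiableAt (by simp)

/-- The derivative in the constant direction `u`, as a derivation. -/
noncomputable def lineDerivation (hW : IsOpen W) (u : E) :
    Derivation ℝ (smoothFunctions W) (smoothFunctions W) :=
  Derivation.mk'
    { toFun := fun f ↦ mk (fun q ↦ fderiv ℝ (zeroExtension f.1) q u)
        (contDiffOn_fderiv_apply hW f.2 contDiffOn_const)
      map_add' := fun f g ↦ by
        refine eq_iff.mpr fun q ↦ ?_
        change fderiv ℝ (zeroExtension (f.1 + g.1)) q u =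
          fderiv ℝ (zeroExtension f.1) q u + fderiv ℝ (zeroExtension g.1) q u
        have h : zeroExtension (f.1 + g.1) =ᶠ[𝓝 (q : E)]
            fun r ↦ zeroExtension f.1 r + zeroExtension g.1 r :=
          Filter.eventually_of_mem (hW.mem_nhds q.2) fun r hr ↦ by simp [zeroExtension_apply _ hr]
        rw [h.fderiv_eq, fderiv_fun_add (differentiableAt hW f.2 q.2) (differentiableAt hW g.2 q.2)]
        rfl
      map_smul' := fun a f ↦ by
        refine eq_iff.mpr fun q ↦ ?_
        change fderiv ℝ (zeroExtension (a • f.1)) q u = a * fderiv ℝ (zeroExtension f.1) q u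
        have h : zeroExtension (a • f.1) =ᶠ[𝓝 (q : E)] fun r ↦ a * zeroExtension f.1 r :=
          Filter.eventually_of_mem (hW.mem_nhds q.2) fun r hr ↦ by simp [zeroExtension_apply _ hr]
        rw [h.fderiv_eq, fderiv_const_mul (differentiableAt hW f.2 q.2)]
        rfl }
    fun f g ↦ by
      refine eq_iff.mpr fun q ↦ ?_
      change fderiv ℝ (zeroExtension (f.1 * g.1)) q u =
        f.1 q * fderiv ℝ (zeroExtension g.1) q u + g.1 q * fderiv ℝ (zeroExtension f.1) q u
      have h : zeroExtension (f.1 * g.1) =ᶠ[𝓝 (q : E)]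
          fun r ↦ zeroExtension f.1 r * zeroExtension g.1 r :=
        Filter.eventually_of_mem (hW.mem_nhds q.2) fun r hr ↦ by simp [zeroExtension_apply _ hr]
      rw [h.fderiv_eq, fderiv_fun_mul (differentiableAt hW f.2 q.2) (differentiableAt hW g.2 q.2)]
      simp [zeroExtension_apply _ q.2]

theorem lineDerivation_apply (hW : IsOpen W) (u : E) (f : smoothFunctions W) (q : W) :
    (lineDerivation hW u f).1 q = fderiv ℝ (zeroExtension f.1) q u := rfl

theorem lineDerivation_mk (hW : IsOpen W) (u : E) (f : E → ℝ) (hf : ContDiffOn ℝ ∞ f W) (q : W) :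
    (lineDerivation hW u (mk f hf)).1 q = fderiv ℝ f q u := by
  rw [lineDerivation_apply]
  exact DFunLike.congr_fun (zeroExtension_mk_eventuallyEq hW f q.2).fderiv_eq u

theorem lineDerivation_comm (hW : IsOpen W) (u v : E) (f : smoothFunctions W) :
    lineDerivation hW u (lineDerivation hW v f) = lineDerivation hW v (lineDerivation hW u f) := by
  refine eq_iff.mpr fun q ↦ ?_
  have h : ∀ u v : E, (lineDerivation hW u (lineDerivation hW v f)).1 q =
      fderiv ℝ (fderiv ℝ (zeroExtension f.1)) q u v := by
    intro u v
    change (lineDerivation hW u (mk _ _)).1 q = _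
    rw [lineDerivation_mk]
    have hd : DifferentiableAt ℝ (fderiv ℝ (zeroExtension f.1)) q :=
      ((ContDiffOn.fderiv_of_isOpen (m := ∞) f.2 hW (by simp)).contDiffAt
        (hW.mem_nhds q.2)).differentiableAt (by simp)
    rw [fderiv_clm_apply hd (differentiableAt_const v)]
    simp
  rw [h, h]
  exact (ContDiffAt.isSymmSndFDerivAt (n := ∞) (f.2.contDiffAt (hW.mem_nhds q.2))
    (by rw [minSmoothness_of_isRCLikeNormedField]
        exact WithTop.coe_le_coe.mpr (le_top : (2 : ℕ∞) ≤ ⊤))) u v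

end smoothFunctions

end SmoothFunctions

/-! ### Functions on the BCV space -/

namespace BCV

open smoothFunctions

variable {W : Set R3}

theorem contDiff_coord (i : Fin 3) : ContDiff ℝ ∞ (fun q : R3 ↦ q i) :=
  (EuclideanSpace.proj (𝕜 := ℝ) i).contDiff

theorem fderiv_coord (i : Fin 3) (q u : R3) : fderiv ℝ (fun q : R3 ↦ q i) q u = u i := by
  exact DFunLike.congr_fun
    ((EuclideanSpace.proj i : R3 →L[ℝ] ℝ).fderiv (x := q)) u

/-- The smooth functions on an open subset of `ℝ³`, with the partial derivatives. -/
noncomputable def coordinateAlgebra (hW : IsOpen W) : CoordinateAlgebra (smoothFunctions W) where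
  d i := lineDerivation hW (EuclideanSpace.single i 1)
  x := mk (fun q ↦ q 0) (contDiff_coord 0).contDiffOn
  y := mk (fun q ↦ q 1) (contDiff_coord 1).contDiffOn
  comm i j h := lineDerivation_comm hW _ _ h
  d_x := by
    refine ⟨eq_iff.mpr fun q ↦ ?_, eq_iff.mpr fun q ↦ ?_, eq_iff.mpr fun q ↦ ?_⟩ <;>
    · rw [lineDerivation_mk, fderiv_coord]
      simp
  d_y := by
    refine ⟨eq_iff.mpr fun q ↦ ?_, eq_iff.mpr fun q ↦ ?_, eq_iff.mpr fun q ↦ ?_⟩ <;>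
    · rw [lineDerivation_mk, fderiv_coord]
      simp

variable (m l : ℝ)

theorem E1_mk (hW : IsOpen W) (h : R3 → ℝ) (hh : ContDiffOn ℝ ∞ h W) (q : W) :
    ((coordinateAlgebra hW).E1 m l (mk h hh)).1 q = fderiv ℝ h q (E1 m l q) := by
  have e : E1 m l q = F m q • EuclideanSpace.single (0 : Fin 3) (1 : ℝ)
      - (l / 2 * (q : R3) 1) • EuclideanSpace.single (2 : Fin 3) (1 : ℝ) := by
    ext i
    fin_cases i <;> simp [E1]
    ring
  rw [e, map_sub, map_smul, map_smul, ← lineDerivation_mk hW _ h hh, ← lineDerivation_mk hW _ h hh]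
  rfl

theorem E2_mk (hW : IsOpen W) (h : R3 → ℝ) (hh : ContDiffOn ℝ ∞ h W) (q : W) :
    ((coordinateAlgebra hW).E2 m l (mk h hh)).1 q = fderiv ℝ h q (E2 m l q) := by
  have e : E2 m l q = F m q • EuclideanSpace.single (1 : Fin 3) (1 : ℝ)
      + (l / 2 * (q : R3) 0) • EuclideanSpace.single (2 : Fin 3) (1 : ℝ) := by
    ext i
    fin_cases i <;> simp [E2]
    ring
  rw [e, map_add, map_smul, map_smul, ← lineDerivation_mk hW _ h hh, ← lineDerivation_mk hW _ h hh]
  rfl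

theorem E3_mk (hW : IsOpen W) (h : R3 → ℝ) (hh : ContDiffOn ℝ ∞ h W) (q : W) :
    ((coordinateAlgebra hW).E3 (mk h hh)).1 q = fderiv ℝ h q (E3 q) := by
  have e : E3 q = EuclideanSpace.single (2 : Fin 3) (1 : ℝ) := by
    ext i
    fin_cases i <;> simp [E3]
  rw [e, ← lineDerivation_mk hW _ h hh]
  rfl

theorem contDiff_F : ContDiff ℝ ∞ (F m) := by
  have h0 := contDiff_coord 0
  have h1 := contDiff_coord 1
  unfold F
  fun_prop

theorem contDiff_E1 : ContDiff ℝ ∞ (E1 m l) := by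
  have h0 := contDiff_coord 1
  have h1 := contDiff_F m
  rw [contDiff_euclidean]
  intro i
  fin_cases i <;> simp [E1] <;> fun_prop

theorem contDiff_E2 : ContDiff ℝ ∞ (E2 m l) := by
  have h0 := contDiff_coord 0
  have h1 := contDiff_F m
  rw [contDiff_euclidean]
  intro i
  fin_cases i <;> simp [E2] <;> fun_prop

theorem contDiff_E3 : ContDiff ℝ ∞ E3 := contDiff_const

/-- For a Riemannian submersion with vertical field `e₃ = s (p E₁ + q E₂) + c E₃`, `s ≠ 0`, the
horizontal field `e = p E₂ - q E₁` maps functions that are constant along the fibres to functions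
that are constant along the fibres. The submersion enters through two functions `h₁`, `h₂`
constant along the fibres, for which the components of the metric of the base are constant along
the fibres too. -/
theorem fderiv_fderiv_eq_zero (hml : 4 * m - l ^ 2 ≠ 0) (hW : IsOpen W) {p q s c : R3 → ℝ}
    (hp : ContDiffOn ℝ ∞ p W) (hq : ContDiffOn ℝ ∞ q W) (hs : ContDiffOn ℝ ∞ s W)
    (hc : ContDiffOn ℝ ∞ c W) (hpq : ∀ r ∈ W, p r ^ 2 + q r ^ 2 = 1)
    (hsc : ∀ r ∈ W, s r ^ 2 + c r ^ 2 = 1) (hs0 : ∀ r ∈ W, s r ≠ 0) {e e₂ e₃ : R3 → R3}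
    (he : ∀ r ∈ W, e r = p r • E2 m l r - q r • E1 m l r)
    (he₂ : ∀ r ∈ W, e₂ r = c r • (p r • E1 m l r + q r • E2 m l r) - s r • E3 r)
    (he₃ : ∀ r ∈ W, e₃ r = s r • (p r • E1 m l r + q r • E2 m l r) + c r • E3 r)
    {h : Fin 2 → R3 → ℝ} (hh : ∀ i, ContDiffOn ℝ ∞ (h i) W)
    (hh₃ : ∀ i, ∀ r ∈ W, fderiv ℝ (h i) r (e₃ r) = 0)
    (hk : ∀ i j, ∀ r ∈ W, fderiv ℝ (fun r ↦ fderiv ℝ (h i) r (e r) * fderiv ℝ (h j) r (e r)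
      + fderiv ℝ (h i) r (e₂ r) * fderiv ℝ (h j) r (e₂ r)) r (e₃ r) = 0)
    (hΔ : ∀ r ∈ W, fderiv ℝ (h 0) r (e r) * fderiv ℝ (h 1) r (e₂ r)
      - fderiv ℝ (h 0) r (e₂ r) * fderiv ℝ (h 1) r (e r) ≠ 0)
    {k : R3 → ℝ} (hk' : ContDiffOn ℝ ∞ k W) (hk₃ : ∀ r ∈ W, fderiv ℝ k r (e₃ r) = 0) :
    ∀ r ∈ W, fderiv ℝ (fun r ↦ fderiv ℝ k r (e r)) r (e₃ r) = 0 := by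
  let G : RotatedFrame (coordinateAlgebra hW) m l :=
    { p := mk p hp
      q := mk q hq
      s := mk s hs
      c := mk c hc
      si := mk (fun r ↦ (s r)⁻¹) (hs.inv hs0)
      sq_p_q := eq_iff.mpr fun r ↦ hpq r r.2
      sq_s_c := eq_iff.mpr fun r ↦ hsc r r.2
      s_mul := eq_iff.mpr fun r ↦ mul_inv_cancel₀ (hs0 r r.2) }
  have hE1 := (contDiff_E1 m l).contDiffOn (s := W)
  have hE2 := (contDiff_E2 m l).contDiffOn (s := W)
  have hE3 := contDiff_E3.contDiffOn (s := W)
  have hes : ContDiffOn ℝ ∞ e W := ((hp.smul hE2).sub (hq.smul hE1)).congr he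
  have he₂s : ContDiffOn ℝ ∞ e₂ W :=
    ((hc.smul ((hp.smul hE1).add (hq.smul hE2))).sub (hs.smul hE3)).congr he₂
  have Ge : ∀ g (hg : ContDiffOn ℝ ∞ g W), G.e (mk g hg) =
      mk (fun r ↦ fderiv ℝ g r (e r)) (contDiffOn_fderiv_apply hW hg hes) := by
    refine fun g hg ↦ eq_iff.mpr fun r ↦ ?_
    rw [G.e_apply]
    change p r * ((coordinateAlgebra hW).E2 m l (mk g hg)).1 r
      - q r * ((coordinateAlgebra hW).E1 m l (mk g hg)).1 r = fderiv ℝ g r (e r)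
    rw [he r r.2, E1_mk, E2_mk]
    simp
  have Ge₂ : ∀ g (hg : ContDiffOn ℝ ∞ g W), G.e2 (mk g hg) =
      mk (fun r ↦ fderiv ℝ g r (e₂ r)) (contDiffOn_fderiv_apply hW hg he₂s) := by
    refine fun g hg ↦ eq_iff.mpr fun r ↦ ?_
    rw [G.e2_apply, G.X_apply, G.Z_apply]
    change c r * (p r * ((coordinateAlgebra hW).E1 m l (mk g hg)).1 r
      + q r * ((coordinateAlgebra hW).E2 m l (mk g hg)).1 r)
      - s r * ((coordinateAlgebra hW).E3 (mk g hg)).1 r = fderiv ℝ g r (e₂ r)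
    rw [he₂ r r.2, E1_mk, E2_mk, E3_mk]
    simp [mul_add]
  have Ge₃ : ∀ g (hg : ContDiffOn ℝ ∞ g W),
      (∀ r ∈ W, fderiv ℝ g r (e₃ r) = 0) ↔ G.e3 (mk g hg) = 0 := by
    refine fun g hg ↦ Iff.trans ?_ eq_iff.symm
    have key : ∀ r : W, (G.e3 (mk g hg)).1 r = fderiv ℝ g r (e₃ r) := by
      intro r
      rw [G.e3_apply, G.X_apply, G.Z_apply]
      change s r * (p r * ((coordinateAlgebra hW).E1 m l (mk g hg)).1 r
        + q r * ((coordinateAlgebra hW).E2 m l (mk g hg)).1 r)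
        + c r * ((coordinateAlgebra hW).E3 (mk g hg)).1 r = fderiv ℝ g r (e₃ r)
      rw [he₃ r r.2, E1_mk, E2_mk, E3_mk]
      simp [mul_add]
    simp only [key]
    exact ⟨fun h r ↦ h r r.2, fun h r hr ↦ h ⟨r, hr⟩⟩
  have hK : ∀ i j, G.e3 (G.e (mk (h i) (hh i)) * G.e (mk (h j) (hh j))
      + G.e2 (mk (h i) (hh i)) * G.e2 (mk (h j) (hh j))) = 0 := by
    intro i j
    rw [Ge, Ge, Ge₂, Ge₂]
    exact (Ge₃ _ (((contDiffOn_fderiv_apply hW (hh i) hes).mul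
      (contDiffOn_fderiv_apply hW (hh j) hes)).add ((contDiffOn_fderiv_apply hW (hh i) he₂s).mul
      (contDiffOn_fderiv_apply hW (hh j) he₂s)))).mp (hk i j)
  refine (Ge₃ _ (contDiffOn_fderiv_apply hW hk' hes)).mpr ?_
  rw [← Ge k hk']
  refine G.e3_e_eq_zero hml (mk (h 0) (hh 0)) (mk (h 1) (hh 1)) ((Ge₃ _ _).mp (hh₃ 0))
    ((Ge₃ _ _).mp (hh₃ 1)) (hK 0 0) (hK 0 1) (hK 1 1) ?_ _ ((Ge₃ _ _).mp hk₃)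
  rw [Ge, Ge, Ge₂, Ge₂]
  exact isUnit_of_ne_zero fun r ↦ hΔ r r.2

end BCV

/-! ### Local sections of submersions -/

/-- A submersion has local sections, and locally every function whose differential vanishes on the
vertical vectors factors through the submersion: it is determined by its values along a section. -/
theorem ContDiffOn.exists_local_section {E F : Type*} [NormedAddCommGroup E] [NormedSpace ℝ E]
    [FiniteDimensional ℝ E] [NormedAddCommGroup F] [NormedSpace ℝ F] [FiniteDimensional ℝ F]
    {Φ : E → F} {W : Set E} (hW : IsOpen W) (hΦ : ContDiffOn ℝ ∞ Φ W) {p : E} (hp : p ∈ W)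
    (hsurj : Function.Surjective (fderiv ℝ Φ p)) :
    ∃ U : Set E, IsOpen U ∧ p ∈ U ∧ U ⊆ W ∧ ∃ V : Set F, IsOpen V ∧ Set.MapsTo Φ U V ∧
      ∃ σ : F → E, ContDiffOn ℝ ∞ σ V ∧ (∀ y ∈ V, σ y ∈ U ∧ Φ (σ y) = y) ∧
        ∀ k : E → ℝ, DifferentiableOn ℝ k U →
          (∀ q ∈ U, ∀ u, fderiv ℝ Φ q u = 0 → fderiv ℝ k q u = 0) →
          ∀ q ∈ U, k (σ (Φ q)) = k q := by
  have : CompleteSpace E := FiniteDimensional.complete ℝ E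
  -- Straighten `Φ`: complete it to a local diffeomorphism `Ψ = (Φ, P)` with `P` linear.
  obtain ⟨P, hP⟩ := ContinuousLinearMap.ker_closedComplemented_of_finiteDimensional_range
    (fderiv ℝ Φ p)
  have hbij : Function.Bijective ((fderiv ℝ Φ p).prod P) := by
    constructor
    · refine (injective_iff_map_eq_zero _).mpr fun u hu ↦ ?_
      have h1 : fderiv ℝ Φ p u = 0 := congrArg Prod.fst hu
      have h2 : P u = 0 := congrArg Prod.snd hu
      have h3 := hP ⟨u, h1⟩
      rw [h2] at h3
      exact (congrArg Subtype.val h3).symm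
    · rintro ⟨a, b⟩
      obtain ⟨u, rfl⟩ := hsurj a
      refine ⟨u + (b - P u : (fderiv ℝ Φ p).ker), ?_⟩
      have h1 : fderiv ℝ Φ p (b - P u : (fderiv ℝ Φ p).ker) = 0 := (b - P u).2
      refine Prod.ext ?_ ?_
      · change fderiv ℝ Φ p (u + (b - P u : (fderiv ℝ Φ p).ker)) = fderiv ℝ Φ p u
        rw [map_add, h1, add_zero]
      · change P (u + (b - P u : (fderiv ℝ Φ p).ker)) = b
        rw [map_add, hP, add_sub_cancel]
  let A : E ≃L[ℝ] F × (fderiv ℝ Φ p).ker :=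
    (LinearEquiv.ofBijective ((fderiv ℝ Φ p).prod P).toLinearMap hbij).toContinuousLinearEquiv
  have hA : (A : E →L[ℝ] F × (fderiv ℝ Φ p).ker) = (fderiv ℝ Φ p).prod P := by
    ext u <;> rfl
  let Ψ : E → F × (fderiv ℝ Φ p).ker := fun u ↦ (Φ u, P u)
  have hΨ : ContDiffOn ℝ ∞ Ψ W := hΦ.prodMk P.contDiff.contDiffOn
  have hd : ∀ q ∈ W, HasFDerivAt Ψ ((fderiv ℝ Φ q).prod P) q := fun q hq ↦
    (((hΦ.contDiffAt (hW.mem_nhds hq)).differentiableAt (by simp)).hasFDerivAt).prodMk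
      P.hasFDerivAt
  have hdp : HasFDerivAt Ψ (A : E →L[ℝ] F × (fderiv ℝ Φ p).ker) p := by
    rw [hA]; exact hd p hp
  have hΨp := hΨ.contDiffAt (hW.mem_nhds hp)
  let R := hΨp.toOpenPartialHomeomorph Ψ hdp (by simp)
  have hRp : p ∈ R.source := hΨp.mem_toOpenPartialHomeomorph_source hdp (by simp)
  have hR : ∀ u, R u = Ψ u := fun u ↦ rfl
  let S : Set E := W ∩ fderiv ℝ Ψ ⁻¹'
    interior (Set.range ((↑) : (E ≃L[ℝ] F × (fderiv ℝ Φ p).ker) → _))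
  have hS : IsOpen S :=
    (hΨ.fderiv_of_isOpen (m := ∞) hW (by simp)).continuousOn.isOpen_inter_preimage hW
      isOpen_interior
  have hpS : p ∈ S := by
    refine ⟨hp, ?_⟩
    rw [Set.mem_preimage, hdp.fderiv]
    exact mem_interior_iff_mem_nhds.mpr A.nhds
  have hΩ : R.symm.source ∩ R.symm ⁻¹' S ∈ 𝓝 (Φ p, P p) :=
    (R.symm.isOpen_inter_preimage hS).mem_nhds ⟨R.map_source hRp, by
      change R.symm (R p) ∈ S
      rwa [R.left_inv hRp]⟩
  obtain ⟨V, B, hV, hpV, hB, hpB, hVB⟩ := mem_nhds_prod_iff'.mp hΩ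
  obtain ⟨ε, hε, hεB⟩ := Metric.isOpen_iff.mp hB _ hpB
  have hsub : V ×ˢ Metric.ball (P p) ε ⊆ R.symm.source ∩ R.symm ⁻¹' S :=
    (Set.prod_mono_right hεB).trans hVB
  have hmk : ∀ y ∈ V, ∀ b ∈ Metric.ball (P p) ε, (y, b) ∈ V ×ˢ Metric.ball (P p) ε :=
    fun y hy b hb ↦ ⟨hy, hb⟩
  have hinv : ∀ y ∈ V, ∀ b ∈ Metric.ball (P p) ε,
      Φ (R.symm (y, b)) = y ∧ P (R.symm (y, b)) = b := by
    intro y hy b hb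
    have h1 : Ψ (R.symm (y, b)) = (y, b) := R.right_inv (hsub (hmk y hy b hb)).1
    exact ⟨congrArg Prod.fst h1, congrArg Prod.snd h1⟩
  have hsmooth : ∀ y ∈ V, ∀ b ∈ Metric.ball (P p) ε, ContDiffAt ℝ ∞ R.symm (y, b) := by
    intro y hy b hb
    obtain ⟨h1, h2, h3⟩ := hsub (hmk y hy b hb)
    obtain ⟨A', hA'⟩ := interior_subset h3
    refine R.contDiffAt_symm h1 (f₀' := A') ?_ (hΨ.contDiffAt (hW.mem_nhds h2))
    rw [hA']
    exact (hd _ h2).differentiableAt.hasFDerivAt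
  have hUmem : ∀ y ∈ V, ∀ b ∈ Metric.ball (P p) ε,
      R.symm (y, b) ∈ R.source ∩ R ⁻¹' (V ×ˢ Metric.ball (P p) ε) := by
    intro y hy b hb
    refine ⟨R.symm.map_source (hsub (hmk y hy b hb)).1, ?_⟩
    rw [Set.mem_preimage, R.right_inv (hsub (hmk y hy b hb)).1]
    exact ⟨hy, hb⟩
  refine ⟨R.source ∩ R ⁻¹' (V ×ˢ Metric.ball (P p) ε),
    R.isOpen_inter_preimage (hV.prod Metric.isOpen_ball), ⟨hRp, hpV, Metric.mem_ball_self hε⟩,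
    fun q hq ↦ ?_, V, hV, fun q hq ↦ hq.2.1, fun y ↦ R.symm (y, P p), ?_, ?_, ?_⟩
  · have := (hsub hq.2).2.1
    rwa [R.left_inv hq.1] at this
  · intro y hy
    exact ((hsmooth y hy _ (Metric.mem_ball_self hε)).comp y
      (contDiffAt_id.prodMk contDiffAt_const)).contDiffWithinAt
  · exact fun y hy ↦ ⟨hUmem y hy _ (Metric.mem_ball_self hε),
      (hinv y hy _ (Metric.mem_ball_self hε)).1⟩
  · intro k hk hk0 q hq
    have hUo : IsOpen (R.source ∩ R ⁻¹' (V ×ˢ Metric.ball (P p) ε)) :=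
      R.isOpen_inter_preimage (hV.prod Metric.isOpen_ball)
    have hder : ∀ b ∈ Metric.ball (P p) ε,
        HasFDerivAt (fun b ↦ k (R.symm (Φ q, b))) (0 : (fderiv ℝ Φ p).ker →L[ℝ] ℝ) b := by
      intro b hb
      have hx := hUmem _ hq.2.1 b hb
      have hxW : R.symm (Φ q, b) ∈ W := (hsub (hmk _ hq.2.1 b hb)).2.1
      have h1 := ((hsmooth _ hq.2.1 b hb).differentiableAt (by simp)).hasFDerivAt.comp b
        (hasFDerivAt_prodMk_right (𝕜 := ℝ) (Φ q) b)
      have h2 := ((hk _ hx).differentiableAt (hUo.mem_nhds hx)).hasFDerivAt.comp b h1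
      have h3 := ((hΦ.contDiffAt (hW.mem_nhds hxW)).differentiableAt
        (by simp)).hasFDerivAt.comp b h1
      have h4 := h3.congr_of_eventuallyEq (f₁ := fun _ ↦ Φ q)
        (Filter.eventually_of_mem (Metric.isOpen_ball.mem_nhds hb)
          fun b' hb' ↦ (hinv _ hq.2.1 b' hb').1.symm)
      have h5 := h4.unique (hasFDerivAt_const (Φ q) b)
      exact h2.congr_fderiv
        (ContinuousLinearMap.ext fun w ↦ hk0 _ hx _ (DFunLike.congr_fun h5 w))
    have := Metric.isOpen_ball.is_const_of_fderiv_eq_zero (𝕜 := ℝ)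
      (Metric.isPreconnected_ball) (fun b hb ↦ (hder b hb).differentiableAt.differentiableWithinAt)
      (fun b hb ↦ (hder b hb).fderiv) (Metric.mem_ball_self hε) hq.2.2
    refine this.trans (congrArg k ?_)
    exact R.left_inv hq.1

/-! ### The BCV metric in the orthonormal frame -/

namespace BCV

theorem theta_E1 {m : ℝ} (l : ℝ) {q : R3} (hq : q ∈ space m) : theta m l q (E1 m l q) = 0 := by
  have : F m q ≠ 0 := hq
  simp [theta, E1]
  field_simp
  ring

theorem theta_E2 {m : ℝ} (l : ℝ) {q : R3} (hq : q ∈ space m) : theta m l q (E2 m l q) = 0 := by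
  have : F m q ≠ 0 := hq
  simp [theta, E2]
  field_simp
  ring

theorem theta_E3 (m l : ℝ) (q : R3) : theta m l q (E3 q) = 1 := by
  simp [theta, E3]

theorem theta_combination {m : ℝ} (l : ℝ) {q : R3} (hq : q ∈ space m) (a b c : ℝ) :
    theta m l q (a • E1 m l q + b • E2 m l q + c • E3 q) = c := by
  have h : theta m l q (a • E1 m l q + b • E2 m l q + c • E3 q) = a * theta m l q (E1 m l q)
      + b * theta m l q (E2 m l q) + c * theta m l q (E3 q) := by
    simp only [theta, PiLp.add_apply, PiLp.smul_apply, smul_eq_mul]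
    ring
  rw [h, theta_E1 l hq, theta_E2 l hq, theta_E3]
  ring

/-- `(E₁, E₂, E₃)` is orthonormal. -/
theorem metric_combination {m : ℝ} (l : ℝ) {q : R3} (hq : q ∈ space m) (a b c a' b' c' : ℝ) :
    metric m l q (a • E1 m l q + b • E2 m l q + c • E3 q)
      (a' • E1 m l q + b' • E2 m l q + c' • E3 q) = a * a' + b * b' + c * c' := by
  rw [metric, theta_combination l hq, theta_combination l hq]
  have : F m q ≠ 0 := hq
  simp [E1, E2, E3]
  field_simp

theorem exists_eq_combination {m : ℝ} (l : ℝ) {q : R3} (hq : q ∈ space m) (u : R3) :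
    ∃ a b c : ℝ, u = a • E1 m l q + b • E2 m l q + c • E3 q := by
  have : F m q ≠ 0 := hq
  refine ⟨u 0 / F m q, u 1 / F m q, theta m l q u, ?_⟩
  ext i
  fin_cases i <;> simp [E1, E2, E3, theta]
  · field_simp
  · field_simp
  · field_simp
    ring

theorem metric_smul_right (m l : ℝ) (q u v : R3) (t : ℝ) :
    metric m l q u (t • v) = t * metric m l q u v := by
  simp only [metric, theta, PiLp.smul_apply, smul_eq_mul]
  ring

/-! ### Riemannian submersions in coordinates of the base -/

/-- The coordinate plane. Only its smooth structure is used. -/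
abbrev R2 : Type := EuclideanSpace ℝ (Fin 2)

/-- The symmetric bilinear form on `ℝ²` with matrix `!![a, b; b, c]`. -/
def form (a b c : ℝ) (u v : R2) : ℝ :=
  a * (u 0 * v 0) + b * (u 0 * v 1 + u 1 * v 0) + c * (u 1 * v 1)

/-- The Gram determinant of two vectors is the square of their determinant times the determinant
of the form. -/
theorem sq_mul_det_eq_one {a b c : ℝ} {u v : R2} (huu : form a b c u u = 1)
    (huv : form a b c u v = 0) (hvv : form a b c v v = 1) :
    (u 0 * v 1 - v 0 * u 1) ^ 2 * (a * c - b ^ 2) = 1 := by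
  simp only [form] at huu huv hvv
  linear_combination (a * (v 0 * v 0) + b * (v 0 * v 1 + v 1 * v 0) + c * (v 1 * v 1)) * huu
    - (a * (u 0 * v 0) + b * (u 0 * v 1 + u 1 * v 0) + c * (u 1 * v 1)) * huv + hvv

theorem det_ne_zero {a b c : ℝ} {u v : R2} (huu : form a b c u u = 1)
    (huv : form a b c u v = 0) (hvv : form a b c v v = 1) : u 0 * v 1 - v 0 * u 1 ≠ 0 := by
  intro h
  have := sq_mul_det_eq_one huu huv hvv
  simp [h] at this

/-- If the columns `u`, `v` of `M` are orthonormal for the bilinear form with matrix `A`, then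
`M * Mᵀ` is the inverse matrix of `A`. -/
theorem sum_mul_of_orthonormal {a b c : ℝ} {u v : R2} (huu : form a b c u u = 1)
    (huv : form a b c u v = 0) (hvv : form a b c v v = 1) :
    u 0 * u 0 + v 0 * v 0 = c / (a * c - b ^ 2) ∧
    u 0 * u 1 + v 0 * v 1 = -b / (a * c - b ^ 2) ∧
    u 1 * u 1 + v 1 * v 1 = a / (a * c - b ^ 2) := by
  have hD : a * c - b ^ 2 ≠ 0 := fun h ↦ by
    have := sq_mul_det_eq_one huu huv hvv
    simp [h] at this
  have key : (!![u 0, v 0; u 1, v 1] : Matrix (Fin 2) (Fin 2) ℝ) *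
      (!![u 0, u 1; v 0, v 1] * !![a, b; b, c]) = 1 := by
    rw [mul_eq_one_comm]
    simp only [form] at huu huv hvv
    ext i j
    fin_cases i <;> fin_cases j <;> simp [Matrix.mul_apply, Fin.sum_univ_two] <;> linarith
  have h00 := congrFun (congrFun key 0) 0
  have h01 := congrFun (congrFun key 0) 1
  have h10 := congrFun (congrFun key 1) 0
  have h11 := congrFun (congrFun key 1) 1
  simp [Matrix.mul_apply, Fin.sum_univ_two] at h00 h01 h10 h11
  refine ⟨?_, ?_, ?_⟩ <;> rw [eq_div_iff hD]
  · linear_combination c * h00 - b * h01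
  · linear_combination a * h01 - b * h00
  · linear_combination a * h11 - b * h10

/-- A Riemannian submersion in coordinates of the base: a submersion `Φ` from an open set `W` of
the BCV space to an open set `V` of the plane with the Riemannian metric
`a dx² + 2 b dx dy + c dy²`. -/
structure IsCoordinateSubmersion (m l : ℝ) (Φ : R3 → R2) (W : Set R3) (V : Set R2)
    (a b c : R2 → ℝ) : Prop where
  isOpen_source : IsOpen W
  subset_space : W ⊆ space m
  smooth : ContDiffOn ℝ ∞ Φ W
  surjective : ∀ q ∈ W, Function.Surjective (fderiv ℝ Φ q)
  isOpen_target : IsOpen V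
  mapsTo : Set.MapsTo Φ W V
  smooth_a : ContDiffOn ℝ ∞ a V
  smooth_b : ContDiffOn ℝ ∞ b V
  smooth_c : ContDiffOn ℝ ∞ c V
  pos : ∀ y ∈ V, 0 < a y
  det_pos : ∀ y ∈ V, 0 < a y * c y - b y ^ 2
  isometry : ∀ q ∈ W, ∀ u v : R3, (∀ w, fderiv ℝ Φ q w = 0 → metric m l q u w = 0) →
    (∀ w, fderiv ℝ Φ q w = 0 → metric m l q v w = 0) →
    form (a (Φ q)) (b (Φ q)) (c (Φ q)) (fderiv ℝ Φ q u) (fderiv ℝ Φ q v) = metric m l q u v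

/-- Near `p` there is an orthonormal frame `(e₁, e₂, e₃)` with `e₃` vertical, `e₁` and `e₂`
related by `Φ` to an orthonormal frame `(η₁, η₂)` of the metric `a dx² + 2 b dx dy + c dy²` of the
plane, and `e₁` without `E₃`-component. -/
def HasAdaptedFrameNear (m l : ℝ) (Φ : R3 → R2) (W : Set R3) (V : Set R2)
    (a b c : R2 → ℝ) (p : R3) : Prop :=
  ∃ U : Set R3, IsOpen U ∧ p ∈ U ∧ U ⊆ W ∧ ∃ e₁ e₂ e₃ : R3 → R3,
    IsOrthonormalFrameOn m l e₁ e₂ e₃ U ∧ (∀ q ∈ U, fderiv ℝ Φ q (e₃ q) = 0) ∧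
    (∃ (V' : Set R2) (η₁ η₂ : R2 → R2), IsOpen V' ∧ V' ⊆ V ∧ Set.MapsTo Φ U V' ∧
      ContDiffOn ℝ ∞ η₁ V' ∧ ContDiffOn ℝ ∞ η₂ V' ∧
      (∀ y ∈ V', form (a y) (b y) (c y) (η₁ y) (η₁ y) = 1) ∧
      (∀ y ∈ V', form (a y) (b y) (c y) (η₂ y) (η₂ y) = 1) ∧
      (∀ y ∈ V', form (a y) (b y) (c y) (η₁ y) (η₂ y) = 0) ∧
      ∀ q ∈ U, fderiv ℝ Φ q (e₁ q) = η₁ (Φ q) ∧ fderiv ℝ Φ q (e₂ q) = η₂ (Φ q)) ∧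
    ∃ α β : R3 → ℝ, ContDiffOn ℝ ∞ α U ∧ ContDiffOn ℝ ∞ β U ∧
      ∀ q ∈ U, e₁ q = α q • E1 m l q + β q • E2 m l q

theorem eq_zero_of_products {A B A' B' : ℝ} (h : A ≠ 0 ∨ B ≠ 0) (h1 : A * A' + A * A' = 0)
    (h2 : A * B' + B * A' = 0) (h3 : B * B' + B * B' = 0) : A' = 0 ∧ B' = 0 := by
  rcases h with h | h
  · have hA : A' = 0 := (mul_eq_zero.mp (by linarith : A * A' = 0)).resolve_left h
    refine ⟨hA, (mul_eq_zero.mp (?_ : A * B' = 0)).resolve_left h⟩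
    rw [hA] at h2
    linarith
  · have hB : B' = 0 := (mul_eq_zero.mp (by linarith : B * B' = 0)).resolve_left h
    refine ⟨(mul_eq_zero.mp (?_ : B * A' = 0)).resolve_left h, hB⟩
    rw [hB] at h2
    linarith

/-- A linear map from `ℝ³` onto `ℝ²` has a one-dimensional kernel. -/
theorem exists_smul_eq_of_surjective {L : R3 →L[ℝ] R2} (hL : Function.Surjective L) {v w : R3}
    (hv : L v = 0) (hv0 : v ≠ 0) (hw : L w = 0) : ∃ t : ℝ, t • v = w := by
  have h1 := LinearMap.finrank_range_add_finrank_ker (L : R3 →ₗ[ℝ] R2)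
  rw [LinearMap.range_eq_top.mpr hL, finrank_top, finrank_euclideanSpace_fin,
    finrank_euclideanSpace_fin] at h1
  have h2 : Module.finrank ℝ (L : R3 →ₗ[ℝ] R2).ker = 1 := by omega
  obtain ⟨t, ht⟩ := (finrank_eq_one_iff_of_nonzero' (⟨v, hv⟩ : (L : R3 →ₗ[ℝ] R2).ker)
    (fun h ↦ hv0 (congrArg Subtype.val h))).mp h2 ⟨w, hw⟩
  exact ⟨t, congrArg Subtype.val ht⟩

namespace IsCoordinateSubmersion

variable {m l : ℝ} {Φ : R3 → R2} {W : Set R3} {V : Set R2} {a b c : R2 → ℝ}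

theorem restrict (h : IsCoordinateSubmersion m l Φ W V a b c) {W' : Set R3} (hW' : IsOpen W')
    (hsub : W' ⊆ W) : IsCoordinateSubmersion m l Φ W' V a b c where
  isOpen_source := hW'
  subset_space := hsub.trans h.subset_space
  smooth := h.smooth.mono hsub
  surjective q hq := h.surjective q (hsub hq)
  isOpen_target := h.isOpen_target
  mapsTo := h.mapsTo.mono_left hsub
  smooth_a := h.smooth_a
  smooth_b := h.smooth_b
  smooth_c := h.smooth_c
  pos := h.pos
  det_pos := h.det_pos
  isometry q hq := h.isometry q (hsub hq)

theorem contDiffOn_fderiv_apply (h : IsCoordinateSubmersion m l Φ W V a b c) {v : R3 → R3}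
    (hv : ContDiffOn ℝ ∞ v W) : ContDiffOn ℝ ∞ (fun q ↦ fderiv ℝ Φ q (v q)) W :=
  (h.smooth.fderiv_of_isOpen h.isOpen_source (by simp)).clm_apply hv

theorem contDiffOn_fderiv_apply_coord (h : IsCoordinateSubmersion m l Φ W V a b c) {v : R3 → R3}
    (hv : ContDiffOn ℝ ∞ v W) (i : Fin 2) : ContDiffOn ℝ ∞ (fun q ↦ fderiv ℝ Φ q (v q) i) W :=
  contDiffOn_euclidean.mp (h.contDiffOn_fderiv_apply hv) i

theorem fderiv_coord (h : IsCoordinateSubmersion m l Φ W V a b c) {q : R3} (hq : q ∈ W)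
    (i : Fin 2) (u : R3) : fderiv ℝ (fun q ↦ Φ q i) q u = fderiv ℝ Φ q u i := by
  have h1 := (h.smooth.contDiffAt (h.isOpen_source.mem_nhds hq)).differentiableAt (by simp)
  have h2 := ((EuclideanSpace.proj i : R2 →L[ℝ] ℝ).hasFDerivAt (x := Φ q)).comp q h1.hasFDerivAt
  exact DFunLike.congr_fun h2.fderiv u

/-- If a vector spanning the kernel of the differential is orthogonal to `u`, then `u` is
horizontal. -/
theorem horizontal (h : IsCoordinateSubmersion m l Φ W V a b c) {q : R3} (hq : q ∈ W) {u v : R3}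
    (hv : fderiv ℝ Φ q v = 0) (hvv : metric m l q v v = 1) (huv : metric m l q u v = 0) :
    ∀ w, fderiv ℝ Φ q w = 0 → metric m l q u w = 0 := by
  intro w hw
  obtain ⟨t, rfl⟩ := exists_smul_eq_of_surjective (h.surjective q hq) hv
    (by rintro rfl; simp [metric, theta] at hvv) hw
  rw [metric_smul_right, huv, mul_zero]

/-- If `E₃` is vertical, horizontal vectors have no `E₃`-component, and every orthonormal frame of
the base lifts. -/
theorem hasAdaptedFrameNear_of_vertical (h : IsCoordinateSubmersion m l Φ W V a b c) {p : R3}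
    (hp : p ∈ W) (hE : ∀ q ∈ W, fderiv ℝ Φ q (E3 q) = 0) :
    HasAdaptedFrameNear m l Φ W V a b c p := by
  have hE1 := (contDiff_E1 m l).contDiffOn (s := W)
  have hE2 := (contDiff_E2 m l).contDiffOn (s := W)
  have hor : ∀ q ∈ W, ∀ α β : ℝ, ∀ w, fderiv ℝ Φ q w = 0 →
      metric m l q (α • E1 m l q + β • E2 m l q) w = 0 := by
    intro q hq α β
    have e1 : metric m l q (E3 q) (E3 q) = 1 := by
      simpa using metric_combination l (h.subset_space hq) 0 0 1 0 0 1
    have e2 : metric m l q (α • E1 m l q + β • E2 m l q) (E3 q) = 0 := by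
      simpa using metric_combination l (h.subset_space hq) α β 0 0 0 1
    exact h.horizontal hq (hE q hq) e1 e2
  have hform : ∀ q ∈ W, ∀ α β α' β' : ℝ, form (a (Φ q)) (b (Φ q)) (c (Φ q))
      (fderiv ℝ Φ q (α • E1 m l q + β • E2 m l q)) (fderiv ℝ Φ q (α' • E1 m l q + β' • E2 m l q)) =
      α * α' + β * β' := by
    intro q hq α β α' β'
    rw [h.isometry q hq _ _ (hor q hq α β) (hor q hq α' β')]
    simpa using metric_combination l (h.subset_space hq) α β 0 α' β' 0
  set u : R3 → R2 := fun q ↦ fderiv ℝ Φ q (E1 m l q) with hu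
  set v : R3 → R2 := fun q ↦ fderiv ℝ Φ q (E2 m l q) with hv
  have hus := h.contDiffOn_fderiv_apply_coord hE1
  have hvs := h.contDiffOn_fderiv_apply_coord hE2
  have hδ : ∀ q ∈ W, u q 0 * v q 1 - v q 0 * u q 1 ≠ 0 := by
    intro q hq
    refine det_ne_zero (a := a (Φ q)) (b := b (Φ q)) (c := c (Φ q)) ?_ ?_ ?_
    · simpa using hform q hq 1 0 1 0
    · simpa using hform q hq 1 0 0 1
    · simpa using hform q hq 0 1 0 1
  -- Vector fields of the base lift to combinations of `E₁` and `E₂`, by Cramer's rule.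
  have lift : ∀ η : R2 → R2, ContDiffOn ℝ ∞ η V → ∃ α β : R3 → ℝ, ContDiffOn ℝ ∞ α W ∧
      ContDiffOn ℝ ∞ β W ∧ ∀ q ∈ W,
        fderiv ℝ Φ q (α q • E1 m l q + β q • E2 m l q) = η (Φ q) := by
    intro η hη
    have hη' := contDiffOn_euclidean.mp (hη.comp h.smooth h.mapsTo)
    refine ⟨fun q ↦ (η (Φ q) 0 * v q 1 - η (Φ q) 1 * v q 0) / (u q 0 * v q 1 - v q 0 * u q 1),
      fun q ↦ (u q 0 * η (Φ q) 1 - u q 1 * η (Φ q) 0) / (u q 0 * v q 1 - v q 0 * u q 1),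
      ?_, ?_, ?_⟩
    · exact (((hη' 0).mul (hvs 1)).sub ((hη' 1).mul (hvs 0))).div
        (((hus 0).mul (hvs 1)).sub ((hvs 0).mul (hus 1))) hδ
    · exact (((hus 0).mul (hη' 1)).sub ((hus 1).mul (hη' 0))).div
        (((hus 0).mul (hvs 1)).sub ((hvs 0).mul (hus 1))) hδ
    · intro q hq
      have := hδ q hq
      rw [map_add, map_smul, map_smul]
      change _ • u q + _ • v q = _
      ext i
      fin_cases i <;> simp <;>
        rw [div_mul_eq_mul_div, div_mul_eq_mul_div, ← add_div, div_eq_iff this] <;> ring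
  -- The Gram-Schmidt frame of the base.
  have hr : ContDiffOn ℝ ∞ (fun y ↦ (√(a y))⁻¹) V :=
    (h.smooth_a.sqrt fun y hy ↦ (h.pos y hy).ne').inv
      fun y hy ↦ (Real.sqrt_pos.mpr (h.pos y hy)).ne'
  have hD : ∀ y ∈ V, 0 < a y * (a y * c y - b y ^ 2) := fun y hy ↦
    mul_pos (h.pos y hy) (h.det_pos y hy)
  have hr' : ContDiffOn ℝ ∞ (fun y ↦ (√(a y * (a y * c y - b y ^ 2)))⁻¹) V :=
    ((h.smooth_a.mul ((h.smooth_a.mul h.smooth_c).sub (h.smooth_b.pow 2))).sqrt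
      fun y hy ↦ (hD y hy).ne').inv fun y hy ↦ (Real.sqrt_pos.mpr (hD y hy)).ne'
  set η₁ : R2 → R2 := fun y ↦ !₂[(√(a y))⁻¹, 0] with hη₁
  set η₂ : R2 → R2 := fun y ↦ !₂[(√(a y * (a y * c y - b y ^ 2)))⁻¹ * -b y,
    (√(a y * (a y * c y - b y ^ 2)))⁻¹ * a y] with hη₂
  have hs₁ : ContDiffOn ℝ ∞ η₁ V := by
    rw [contDiffOn_euclidean]
    intro i
    fin_cases i
    · exact hr
    · exact contDiffOn_const
  have hs₂ : ContDiffOn ℝ ∞ η₂ V := by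
    rw [contDiffOn_euclidean]
    intro i
    fin_cases i
    · exact hr'.mul h.smooth_b.neg
    · exact hr'.mul h.smooth_a
  have n₁ : ∀ y ∈ V, form (a y) (b y) (c y) (η₁ y) (η₁ y) = 1 := by
    intro y hy
    have := Real.sq_sqrt (h.pos y hy).le
    have h0 := (Real.sqrt_pos.mpr (h.pos y hy)).ne'
    simp [form, hη₁]
    field_simp
    exact this.symm
  have n₂ : ∀ y ∈ V, form (a y) (b y) (c y) (η₂ y) (η₂ y) = 1 := by
    intro y hy
    have h1 := Real.sq_sqrt (hD y hy).le
    have h0 := (Real.sqrt_pos.mpr (hD y hy)).ne'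
    simp [form, hη₂]
    set r := √(a y * (a y * c y - b y ^ 2))
    field_simp
    linear_combination -h1
  have n₁₂ : ∀ y ∈ V, form (a y) (b y) (c y) (η₁ y) (η₂ y) = 0 := by
    intro y hy
    simp [form, hη₁, hη₂]
    ring
  obtain ⟨α, β, hα, hβ, h₁⟩ := lift η₁ hs₁
  obtain ⟨α', β', hα', hβ', h₂⟩ := lift η₂ hs₂
  refine ⟨W, h.isOpen_source, hp, subset_rfl, fun q ↦ α q • E1 m l q + β q • E2 m l q,
    fun q ↦ α' q • E1 m l q + β' q • E2 m l q, E3, ?_, hE, ⟨V, η₁, η₂, h.isOpen_target, subset_rfl,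
      h.mapsTo, hs₁, hs₂, n₁, n₂, n₁₂, fun q hq ↦ ⟨h₁ q hq, h₂ q hq⟩⟩, α, β, hα, hβ,
      fun _ _ ↦ rfl⟩
  refine ⟨(hα.smul hE1).add (hβ.smul hE2), (hα'.smul hE1).add (hβ'.smul hE2),
    contDiff_E3.contDiffOn, fun q hq ↦ ?_, fun q hq ↦ ?_, fun q hq ↦ ?_, fun q hq ↦ ?_,
    fun q hq ↦ ?_, fun q hq ↦ ?_⟩
  · rw [← n₁ _ (h.mapsTo hq), ← h₁ q hq]
    exact (h.isometry q hq _ _ (hor q hq _ _) (hor q hq _ _)).symm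
  · rw [← n₂ _ (h.mapsTo hq), ← h₂ q hq]
    exact (h.isometry q hq _ _ (hor q hq _ _) (hor q hq _ _)).symm
  · simpa using metric_combination l (h.subset_space hq) 0 0 1 0 0 1
  · rw [← n₁₂ _ (h.mapsTo hq), ← h₁ q hq, ← h₂ q hq]
    exact (h.isometry q hq _ _ (hor q hq _ _) (hor q hq _ _)).symm
  · exact hor q hq _ _ _ (hE q hq)
  · exact hor q hq _ _ _ (hE q hq)

/-- Where `E₃` is not vertical, the vertical direction is spanned by a unit vector field
`s (p E₁ + q E₂) + c E₃` with `s > 0`, `p² + q² = 1`. -/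
theorem exists_vertical (h : IsCoordinateSubmersion m l Φ W V a b c) {x : R3} (hx : x ∈ W)
    (hE : fderiv ℝ Φ x (E3 x) ≠ 0) :
    ∃ W' : Set R3, IsOpen W' ∧ x ∈ W' ∧ W' ⊆ W ∧ ∃ p q s c : R3 → ℝ,
      ContDiffOn ℝ ∞ p W' ∧ ContDiffOn ℝ ∞ q W' ∧ ContDiffOn ℝ ∞ s W' ∧ ContDiffOn ℝ ∞ c W' ∧
      (∀ r ∈ W', p r ^ 2 + q r ^ 2 = 1) ∧ (∀ r ∈ W', s r ^ 2 + c r ^ 2 = 1) ∧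
      (∀ r ∈ W', s r ≠ 0) ∧ ∀ r ∈ W',
        fderiv ℝ Φ r (s r • (p r • E1 m l r + q r • E2 m l r) + c r • E3 r) = 0 := by
  set u : R3 → R2 := fun q ↦ fderiv ℝ Φ q (E1 m l q) with hu
  set v : R3 → R2 := fun q ↦ fderiv ℝ Φ q (E2 m l q) with hv
  set w : R3 → R2 := fun q ↦ fderiv ℝ Φ q (E3 q) with hw
  have hus := h.contDiffOn_fderiv_apply_coord (contDiff_E1 m l).contDiffOn
  have hvs := h.contDiffOn_fderiv_apply_coord (contDiff_E2 m l).contDiffOn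
  have hws := h.contDiffOn_fderiv_apply_coord contDiff_E3.contDiffOn
  -- The vertical direction is the cross product of the two rows of the differential.
  set n₁ : R3 → ℝ := fun r ↦ v r 0 * w r 1 - w r 0 * v r 1 with hn₁
  set n₂ : R3 → ℝ := fun r ↦ w r 0 * u r 1 - u r 0 * w r 1 with hn₂
  set n₃ : R3 → ℝ := fun r ↦ u r 0 * v r 1 - v r 0 * u r 1 with hn₃
  have s₁ : ContDiffOn ℝ ∞ n₁ W := ((hvs 0).mul (hws 1)).sub ((hws 0).mul (hvs 1))
  have s₂ : ContDiffOn ℝ ∞ n₂ W := ((hws 0).mul (hus 1)).sub ((hus 0).mul (hws 1))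
  have s₃ : ContDiffOn ℝ ∞ n₃ W := ((hus 0).mul (hvs 1)).sub ((hvs 0).mul (hus 1))
  have hρ : ContDiffOn ℝ ∞ (fun r ↦ n₁ r ^ 2 + n₂ r ^ 2) W := (s₁.pow 2).add (s₂.pow 2)
  have hx0 : n₁ x ^ 2 + n₂ x ^ 2 ≠ 0 := by
    intro h0
    have h1 : n₁ x = 0 := by nlinarith [sq_nonneg (n₁ x), sq_nonneg (n₂ x)]
    have h2 : n₂ x = 0 := by nlinarith [sq_nonneg (n₁ x), sq_nonneg (n₂ x)]
    obtain ⟨ξ, hξ⟩ := h.surjective x hx !₂[w x 1, -w x 0]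
    obtain ⟨α, β, γ, rfl⟩ := exists_eq_combination l (h.subset_space hx) ξ
    rw [map_add, map_add, map_smul, map_smul, map_smul] at hξ
    change α • u x + β • v x + γ • w x = _ at hξ
    have e0 : α * u x 0 + β * v x 0 + γ * w x 0 = w x 1 := by
      simpa using congrArg (fun z : R2 ↦ z 0) hξ
    have e1 : α * u x 1 + β * v x 1 + γ * w x 1 = -w x 0 := by
      simpa using congrArg (fun z : R2 ↦ z 1) hξ
    have e2 : w x 0 ^ 2 + w x 1 ^ 2 = 0 := by
      simp only [hn₁, hn₂] at h1 h2
      linear_combination w x 0 * e1 - w x 1 * e0 + β * h1 - α * h2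
    refine hE ?_
    change w x = 0
    ext i
    fin_cases i <;> simp <;> nlinarith [sq_nonneg (w x 0), sq_nonneg (w x 1)]
  set W' : Set R3 := W ∩ (fun r ↦ n₁ r ^ 2 + n₂ r ^ 2) ⁻¹' {0}ᶜ with hW'
  have hsub : W' ⊆ W := Set.inter_subset_left
  have pos : ∀ r ∈ W', 0 < n₁ r ^ 2 + n₂ r ^ 2 := fun r hr ↦
    lt_of_le_of_ne (by positivity) (Ne.symm hr.2)
  have pos' : ∀ r ∈ W', 0 < n₁ r ^ 2 + n₂ r ^ 2 + n₃ r ^ 2 := fun r hr ↦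
    add_pos_of_pos_of_nonneg (pos r hr) (sq_nonneg _)
  have sρ : ContDiffOn ℝ ∞ (fun r ↦ √(n₁ r ^ 2 + n₂ r ^ 2)) W' :=
    (hρ.mono hsub).sqrt fun r hr ↦ (pos r hr).ne'
  have sν : ContDiffOn ℝ ∞ (fun r ↦ √(n₁ r ^ 2 + n₂ r ^ 2 + n₃ r ^ 2)) W' :=
    ((hρ.add (s₃.pow 2)).mono hsub).sqrt fun r hr ↦ (pos' r hr).ne'
  have ρ0 : ∀ r ∈ W', √(n₁ r ^ 2 + n₂ r ^ 2) ≠ 0 := fun r hr ↦ (Real.sqrt_pos.mpr (pos r hr)).ne'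
  have ν0 : ∀ r ∈ W', √(n₁ r ^ 2 + n₂ r ^ 2 + n₃ r ^ 2) ≠ 0 := fun r hr ↦
    (Real.sqrt_pos.mpr (pos' r hr)).ne'
  refine ⟨W', hρ.continuousOn.isOpen_inter_preimage h.isOpen_source isOpen_compl_singleton,
    ⟨hx, hx0⟩, hsub, fun r ↦ n₁ r / √(n₁ r ^ 2 + n₂ r ^ 2), fun r ↦ n₂ r / √(n₁ r ^ 2 + n₂ r ^ 2),
    fun r ↦ √(n₁ r ^ 2 + n₂ r ^ 2) / √(n₁ r ^ 2 + n₂ r ^ 2 + n₃ r ^ 2),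
    fun r ↦ n₃ r / √(n₁ r ^ 2 + n₂ r ^ 2 + n₃ r ^ 2), (s₁.mono hsub).div sρ ρ0,
    (s₂.mono hsub).div sρ ρ0, sρ.div sν ν0, (s₃.mono hsub).div sν ν0, fun r hr ↦ ?_,
    fun r hr ↦ ?_, fun r hr ↦ div_ne_zero (ρ0 r hr) (ν0 r hr), fun r hr ↦ ?_⟩
  · rw [div_pow, div_pow, ← add_div, Real.sq_sqrt (pos r hr).le, div_self (pos r hr).ne']
  · rw [div_pow, div_pow, ← add_div, Real.sq_sqrt (pos r hr).le, Real.sq_sqrt (pos' r hr).le,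
      div_self (pos' r hr).ne']
  · simp only [map_add, map_smul]
    change _ • (_ • u r + _ • v r) + _ • w r = _
    have e1 := ρ0 r hr
    have e2 := ν0 r hr
    set ρ := √(n₁ r ^ 2 + n₂ r ^ 2)
    set ν := √(n₁ r ^ 2 + n₂ r ^ 2 + n₃ r ^ 2)
    ext i
    fin_cases i
    · simp
      field_simp
      simp only [hn₁, hn₂, hn₃]
      ring
    · simp
      field_simp
      simp only [hn₁, hn₂, hn₃]
      ring

theorem fderiv_comp_eq_zero (h : IsCoordinateSubmersion m l Φ W V a b c) {k : R2 → ℝ}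
    (hk : ContDiffOn ℝ ∞ k V) {r : R3} (hr : r ∈ W) {u : R3} (hu : fderiv ℝ Φ r u = 0)
    {k' : R3 → ℝ} (hk' : ∀ r ∈ W, k' r = k (Φ r)) : fderiv ℝ k' r u = 0 := by
  have h1 := (h.smooth.contDiffAt (h.isOpen_source.mem_nhds hr)).differentiableAt (by simp)
  have h2 := (hk.contDiffAt (h.isOpen_target.mem_nhds (h.mapsTo hr))).differentiableAt (by simp)
  have h3 : k' =ᶠ[𝓝 r] k ∘ Φ := Filter.eventually_of_mem (h.isOpen_source.mem_nhds hr) hk'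
  rw [h3.fderiv_eq, (h2.hasFDerivAt.comp r h1.hasFDerivAt).fderiv, ContinuousLinearMap.comp_apply,
    hu, map_zero]

/-- If `E₃` is not vertical, the horizontal unit field without `E₃`-component is basic. -/
theorem hasAdaptedFrameNear_of_not_vertical (hml : 4 * m - l ^ 2 ≠ 0)
    (h₀ : IsCoordinateSubmersion m l Φ W V a b c) {x : R3}
    (hx₀ : x ∈ W) (hE : fderiv ℝ Φ x (E3 x) ≠ 0) : HasAdaptedFrameNear m l Φ W V a b c x := by
  obtain ⟨W', hW', hx, hsub, p, q, s, t, hp, hq, hs, ht, hpq, hst, hs0, hv⟩ :=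
    h₀.exists_vertical hx₀ hE
  have h := h₀.restrict hW' hsub
  have hE1 := (contDiff_E1 m l).contDiffOn (s := W')
  have hE2 := (contDiff_E2 m l).contDiffOn (s := W')
  have hE3 := contDiff_E3.contDiffOn (s := W')
  set e₁ : R3 → R3 := fun r ↦ p r • E2 m l r - q r • E1 m l r with he₁
  set e₂ : R3 → R3 := fun r ↦ t r • (p r • E1 m l r + q r • E2 m l r) - s r • E3 r with he₂
  set e₃ : R3 → R3 := fun r ↦ s r • (p r • E1 m l r + q r • E2 m l r) + t r • E3 r with he₃
  have hs₁ : ContDiffOn ℝ ∞ e₁ W' := (hp.smul hE2).sub (hq.smul hE1)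
  have hs₂ : ContDiffOn ℝ ∞ e₂ W' := (ht.smul ((hp.smul hE1).add (hq.smul hE2))).sub (hs.smul hE3)
  have hs₃ : ContDiffOn ℝ ∞ e₃ W' := (hs.smul ((hp.smul hE1).add (hq.smul hE2))).add (ht.smul hE3)
  have c₁ : ∀ r, e₁ r = (-q r) • E1 m l r + p r • E2 m l r + (0 : ℝ) • E3 r := by
    intro r; simp only [he₁]; module
  have c₂ : ∀ r, e₂ r = (t r * p r) • E1 m l r + (t r * q r) • E2 m l r + (-s r) • E3 r := by
    intro r; simp only [he₂]; module
  have c₃ : ∀ r, e₃ r = (s r * p r) • E1 m l r + (s r * q r) • E2 m l r + t r • E3 r := by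
    intro r; simp only [he₃]; module
  have frame : IsOrthonormalFrameOn m l e₁ e₂ e₃ W' := by
    refine ⟨hs₁, hs₂, hs₃, fun r hr ↦ ?_, fun r hr ↦ ?_, fun r hr ↦ ?_, fun r hr ↦ ?_,
      fun r hr ↦ ?_, fun r hr ↦ ?_⟩ <;>
      simp only [c₁, c₂, c₃, metric_combination l (h.subset_space hr)]
    · linear_combination hpq r hr
    · linear_combination t r ^ 2 * hpq r hr + hst r hr
    · linear_combination s r ^ 2 * hpq r hr + hst r hr
    · ring
    · ring
    · linear_combination s r * t r * hpq r hr
  have hor₁ : ∀ r ∈ W', ∀ w, fderiv ℝ Φ r w = 0 → metric m l r (e₁ r) w = 0 := fun r hr ↦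
    h.horizontal hr (hv r hr) (frame.norm₃ r hr) (frame.orth₁₃ r hr)
  have hor₂ : ∀ r ∈ W', ∀ w, fderiv ℝ Φ r w = 0 → metric m l r (e₂ r) w = 0 := fun r hr ↦
    h.horizontal hr (hv r hr) (frame.norm₃ r hr) (frame.orth₂₃ r hr)
  set u : R3 → R2 := fun r ↦ fderiv ℝ Φ r (e₁ r) with hu
  set v : R3 → R2 := fun r ↦ fderiv ℝ Φ r (e₂ r) with hv'
  have g₁₁ : ∀ r ∈ W', form (a (Φ r)) (b (Φ r)) (c (Φ r)) (u r) (u r) = 1 := fun r hr ↦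
    (h.isometry r hr _ _ (hor₁ r hr) (hor₁ r hr)).trans (frame.norm₁ r hr)
  have g₁₂ : ∀ r ∈ W', form (a (Φ r)) (b (Φ r)) (c (Φ r)) (u r) (v r) = 0 := fun r hr ↦
    (h.isometry r hr _ _ (hor₁ r hr) (hor₂ r hr)).trans (frame.orth₁₂ r hr)
  have g₂₂ : ∀ r ∈ W', form (a (Φ r)) (b (Φ r)) (c (Φ r)) (v r) (v r) = 1 := fun r hr ↦
    (h.isometry r hr _ _ (hor₂ r hr) (hor₂ r hr)).trans (frame.norm₂ r hr)
  have hΔ : ∀ r ∈ W', u r 0 * v r 1 - v r 0 * u r 1 ≠ 0 := fun r hr ↦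
    det_ne_zero (g₁₁ r hr) (g₁₂ r hr) (g₂₂ r hr)
  have hus := h.contDiffOn_fderiv_apply_coord hs₁
  have hvs := h.contDiffOn_fderiv_apply_coord hs₂
  -- The inverse matrix of the metric of the base is constant along the fibres.
  have hD : ContDiffOn ℝ ∞ (fun y ↦ a y * c y - b y ^ 2) V :=
    (h.smooth_a.mul h.smooth_c).sub (h.smooth_b.pow 2)
  have hD0 : ∀ y ∈ V, a y * c y - b y ^ 2 ≠ 0 := fun y hy ↦ (h.det_pos y hy).ne'
  have k00 : ∀ r ∈ W', fderiv ℝ (fun r ↦ u r 0 * u r 0 + v r 0 * v r 0) r (e₃ r) = 0 :=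
    fun r hr ↦ h.fderiv_comp_eq_zero (h.smooth_c.div hD hD0) hr (hv r hr)
      fun r hr ↦ (sum_mul_of_orthonormal (g₁₁ r hr) (g₁₂ r hr) (g₂₂ r hr)).1
  have k01 : ∀ r ∈ W', fderiv ℝ (fun r ↦ u r 0 * u r 1 + v r 0 * v r 1) r (e₃ r) = 0 :=
    fun r hr ↦ h.fderiv_comp_eq_zero (h.smooth_b.neg.div hD hD0) hr (hv r hr)
      fun r hr ↦ (sum_mul_of_orthonormal (g₁₁ r hr) (g₁₂ r hr) (g₂₂ r hr)).2.1
  have k11 : ∀ r ∈ W', fderiv ℝ (fun r ↦ u r 1 * u r 1 + v r 1 * v r 1) r (e₃ r) = 0 :=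
    fun r hr ↦ h.fderiv_comp_eq_zero (h.smooth_a.div hD hD0) hr (hv r hr)
      fun r hr ↦ (sum_mul_of_orthonormal (g₁₁ r hr) (g₁₂ r hr) (g₂₂ r hr)).2.2
  have k : ∀ i j : Fin 2, ∀ r ∈ W',
      fderiv ℝ (fun r ↦ u r i * u r j + v r i * v r j) r (e₃ r) = 0 := by
    intro i j r hr
    fin_cases i <;> fin_cases j
    · exact k00 r hr
    · exact k01 r hr
    · refine Eq.trans ?_ (k01 r hr)
      congr 3
      ext r
      change u r 1 * u r 0 + v r 1 * v r 0 = _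
      ring
    · exact k11 r hr
  -- `e₁` is basic by the structure equations.
  have ku : ∀ i : Fin 2, ∀ r ∈ W', fderiv ℝ (fun r ↦ u r i) r (e₃ r) = 0 := by
    intro i r hr
    have hcoord : ∀ (v : R3 → R3) (i : Fin 2), ∀ r ∈ W',
        fderiv ℝ (fun q ↦ Φ q i) r (v r) = fderiv ℝ Φ r (v r) i :=
      fun v i r hr ↦ h.fderiv_coord hr i _
    have := fderiv_fderiv_eq_zero m l hml hW' hp hq hs ht hpq hst hs0 (e := e₁) (e₂ := e₂)
      (e₃ := e₃) (fun _ _ ↦ rfl) (fun _ _ ↦ rfl) (fun _ _ ↦ rfl) (h := fun i q ↦ Φ q i)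
      (fun i ↦ contDiffOn_euclidean.mp h.smooth i)
      (fun i r hr ↦ by rw [hcoord _ _ _ hr, hv r hr]; rfl)
      (fun i j r hr ↦ by
        rw [← k i j r hr]
        refine DFunLike.congr_fun (Filter.EventuallyEq.fderiv_eq ?_) _
        filter_upwards [hW'.mem_nhds hr] with z hz
        rw [hcoord _ _ _ hz, hcoord _ _ _ hz, hcoord _ _ _ hz, hcoord _ _ _ hz])
      (fun r hr ↦ by
        rw [hcoord _ _ _ hr, hcoord _ _ _ hr, hcoord _ _ _ hr, hcoord _ _ _ hr]
        exact hΔ r hr)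
      (contDiffOn_euclidean.mp h.smooth i)
      (fun r hr ↦ by rw [hcoord _ _ _ hr, hv r hr]; rfl) r hr
    rw [← this]
    refine DFunLike.congr_fun (Filter.EventuallyEq.fderiv_eq ?_) _
    filter_upwards [hW'.mem_nhds hr] with z hz
    rw [hcoord _ _ _ hz]
  have du : ∀ i : Fin 2, ∀ r ∈ W', DifferentiableAt ℝ (fun r ↦ u r i) r := fun i r hr ↦
    ((hus i).contDiffAt (hW'.mem_nhds hr)).differentiableAt (by simp)
  have dv : ∀ i : Fin 2, ∀ r ∈ W', DifferentiableAt ℝ (fun r ↦ v r i) r := fun i r hr ↦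
    ((hvs i).contDiffAt (hW'.mem_nhds hr)).differentiableAt (by simp)
  -- Hence so is `e₂`: the products of its components are constant along the fibres.
  have kv : ∀ r ∈ W', fderiv ℝ (fun r ↦ v r 0) r (e₃ r) = 0 ∧
      fderiv ℝ (fun r ↦ v r 1) r (e₃ r) = 0 := by
    intro r hr
    have key : ∀ i j : Fin 2, v r i * fderiv ℝ (fun r ↦ v r j) r (e₃ r)
        + v r j * fderiv ℝ (fun r ↦ v r i) r (e₃ r) = 0 := by
      intro i j
      have h1 := k i j r hr
      rw [fderiv_fun_add ((du i r hr).fun_mul (du j r hr)) ((dv i r hr).fun_mul (dv j r hr)),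
        fderiv_fun_mul (du i r hr) (du j r hr), fderiv_fun_mul (dv i r hr) (dv j r hr)] at h1
      simp only [add_apply, smul_apply, smul_eq_mul,
        ku _ r hr] at h1
      linarith
    refine eq_zero_of_products ?_ (key 0 0) (key 0 1) (key 1 1)
    by_contra! hz
    refine hΔ r hr ?_
    rw [hz.1, hz.2]
    ring
  obtain ⟨U, hU, hxU, hUW, V₀, hV₀, hmaps, σ, hσ, hσ', hfac⟩ :=
    h.smooth.exists_local_section hW' hx (h.surjective x hx)
  have basic : ∀ g : R3 → R2, ContDiffOn ℝ ∞ g W' →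
      (∀ i : Fin 2, ∀ r ∈ W', fderiv ℝ (fun r ↦ g r i) r (e₃ r) = 0) →
      ∀ r ∈ U, g (σ (Φ r)) = g r := by
    intro g hg h0 r hr
    ext i
    refine hfac (fun r ↦ g r i) (fun z hz ↦ ?_) (fun z hz w hw ↦ ?_) r hr
    · exact ((contDiffOn_euclidean.mp hg i).contDiffAt
        (hW'.mem_nhds (hUW hz))).differentiableAt (by simp) |>.differentiableWithinAt
    · obtain ⟨τ, rfl⟩ := exists_smul_eq_of_surjective (h.surjective z (hUW hz)) (hv z (hUW hz))
        (fun h0 ↦ by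
          have h1 := frame.norm₃ z (hUW hz)
          have h2 : e₃ z = 0 := h0
          rw [h2] at h1
          simp [metric, theta] at h1) hw
      rw [map_smul]
      have := h0 i z (hUW hz)
      simp only [he₃] at this
      rw [this, smul_zero]
  have hσW : Set.MapsTo σ (V₀ ∩ V) W' := fun y hy ↦ hUW (hσ' y hy.1).1
  have hΦσ : ∀ y ∈ V₀ ∩ V, Φ (σ y) = y := fun y hy ↦ (hσ' y hy.1).2
  have hus' := h.contDiffOn_fderiv_apply hs₁
  have hvs' := h.contDiffOn_fderiv_apply hs₂
  have bu := basic u hus' ku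
  have bv := basic v hvs' fun i r hr ↦ by
    fin_cases i
    · exact (kv r hr).1
    · exact (kv r hr).2
  refine ⟨U, hU, hxU, hUW.trans hsub, e₁, e₂, e₃, ?_, fun r hr ↦ hv r (hUW hr),
    ⟨V₀ ∩ V, fun y ↦ u (σ y), fun y ↦ v (σ y), hV₀.inter h.isOpen_target, Set.inter_subset_right,
      fun r hr ↦ ⟨hmaps hr, h.mapsTo (hUW hr)⟩, hus'.comp (hσ.mono Set.inter_subset_left) hσW,
      hvs'.comp (hσ.mono Set.inter_subset_left) hσW, fun y hy ↦ ?_, fun y hy ↦ ?_, fun y hy ↦ ?_,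
      fun r hr ↦ ⟨(bu r hr).symm, (bv r hr).symm⟩⟩,
    fun r ↦ -q r, p, (hq.mono hUW).neg, hp.mono hUW, fun r _ ↦ ?_⟩
  · exact ⟨hs₁.mono hUW, hs₂.mono hUW, hs₃.mono hUW, fun r hr ↦ frame.norm₁ r (hUW hr),
      fun r hr ↦ frame.norm₂ r (hUW hr), fun r hr ↦ frame.norm₃ r (hUW hr),
      fun r hr ↦ frame.orth₁₂ r (hUW hr), fun r hr ↦ frame.orth₁₃ r (hUW hr),
      fun r hr ↦ frame.orth₂₃ r (hUW hr)⟩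
  · have := g₁₁ _ (hσW hy)
    rwa [hΦσ y hy] at this
  · have := g₂₂ _ (hσW hy)
    rwa [hΦσ y hy] at this
  · have := g₁₂ _ (hσW hy)
    rwa [hΦσ y hy] at this
  · simp only [he₁]; module

end IsCoordinateSubmersion

/-! ### Charts of the base -/

variable {N : Type*} [TopologicalSpace N] [ChartedSpace (EuclideanSpace ℝ (Fin 2)) N]
  [IsManifold (𝓡 2) ∞ N]

/-- The tangent vector at `y` with given coordinates in the chart at `y₀`; used only for `y` in
the domain of the chart. -/
noncomputable def chartVector (y₀ y : N) : R2 →L[ℝ] TangentSpace (𝓡 2) y :=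
  (trivializationAt R2 (TangentSpace (𝓡 2)) y₀).symmL ℝ y

theorem mfderiv_chartVector {y₀ y : N} (hy : y ∈ (chartAt R2 y₀).source) (u : R2) :
    mfderiv (𝓡 2) 𝓘(ℝ, R2) (extChartAt (𝓡 2) y₀) y (chartVector y₀ y u) = u := by
  have : IsManifold (𝓡 2) 1 N := .of_le (n := ∞) (by simp)
  rw [← TangentBundle.continuousLinearMapAt_trivializationAt hy]
  exact (trivializationAt R2 (TangentSpace (𝓡 2)) y₀).continuousLinearMapAt_symmL hy u

theorem chartVector_mfderiv {y₀ y : N} (hy : y ∈ (chartAt R2 y₀).source)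
    (v : TangentSpace (𝓡 2) y) :
    chartVector y₀ y (mfderiv (𝓡 2) 𝓘(ℝ, R2) (extChartAt (𝓡 2) y₀) y v) = v := by
  have : IsManifold (𝓡 2) 1 N := .of_le (n := ∞) (by simp)
  rw [← TangentBundle.continuousLinearMapAt_trivializationAt hy]
  exact (trivializationAt R2 (TangentSpace (𝓡 2)) y₀).symmL_continuousLinearMapAt hy v

theorem contMDiffOn_chartVector {y₀ : N} {s : Set N} (hs : IsOpen s)
    (hsub : s ⊆ (chartAt R2 y₀).source) {η : N → R2} (hη : ContMDiffOn (𝓡 2) 𝓘(ℝ, R2) ∞ η s) :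
    ContMDiffOn (𝓡 2) (𝓡 2).tangent ∞
      (fun y ↦ (⟨y, chartVector y₀ y (η y)⟩ : TangentBundle (𝓡 2) N)) s := by
  refine ((trivializationAt R2 (TangentSpace (𝓡 2)) y₀).contMDiffOn_section_iff hs hsub).mpr ?_
  refine hη.congr fun y hy ↦ ?_
  rw [chartVector, Bundle.Trivialization.symmL_apply _ (hsub hy),
    Bundle.Trivialization.apply_mk_symm _ (hsub hy)]

theorem eq_smul_add_smul (u : R2) : u = u 0 • EuclideanSpace.single 0 (1 : ℝ)
    + u 1 • EuclideanSpace.single 1 (1 : ℝ) := by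
  ext i
  fin_cases i <;> simp

variable [Bundle.RiemannianBundle (fun y : N ↦ TangentSpace (𝓡 2) y)]

/-- The coefficients of the Riemannian metric of a surface in the chart at `y₀`. -/
noncomputable def chartMetric (y₀ : N) (i j : Fin 2) (y : N) : ℝ :=
  inner ℝ (chartVector y₀ y (EuclideanSpace.single i 1))
    (chartVector y₀ y (EuclideanSpace.single j 1))

theorem inner_chartVector (y₀ y : N) (u v : R2) :
    inner ℝ (chartVector y₀ y u) (chartVector y₀ y v) =
      form (chartMetric y₀ 0 0 y) (chartMetric y₀ 0 1 y) (chartMetric y₀ 1 1 y) u v := by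
  have hc : inner ℝ (chartVector y₀ y (EuclideanSpace.single 1 1))
    (chartVector y₀ y (EuclideanSpace.single 0 1)) = chartMetric y₀ 0 1 y := real_inner_comm _ _
  conv_lhs => rw [eq_smul_add_smul u, eq_smul_add_smul v]
  simp only [map_add, map_smul, inner_add_left, inner_add_right, real_inner_smul_left,
    real_inner_smul_right, hc, form]
  simp only [chartMetric]
  ring

theorem chartMetric_pos {y₀ y : N} (hy : y ∈ (chartAt R2 y₀).source) :
    0 < chartMetric y₀ 0 0 y := by
  refine real_inner_self_pos.mpr fun h ↦ ?_
  have h1 : (0 : R2) = EuclideanSpace.single 0 1 := by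
    rw [← mfderiv_chartVector hy (EuclideanSpace.single 0 1), h, map_zero]
    rfl
  simpa using congrArg (fun z : R2 ↦ z 0) h1

theorem chartMetric_det_pos {y₀ y : N} (hy : y ∈ (chartAt R2 y₀).source) :
    0 < chartMetric y₀ 0 0 y * chartMetric y₀ 1 1 y - chartMetric y₀ 0 1 y ^ 2 := by
  have h0 := chartMetric_pos hy
  set u : R2 := !₂[-chartMetric y₀ 0 1 y, chartMetric y₀ 0 0 y] with hu
  have h1 : 0 < inner ℝ (chartVector y₀ y u) (chartVector y₀ y u) := by
    refine real_inner_self_pos.mpr fun h ↦ ?_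
    have h1 : (0 : R2) = u := by
      rw [← mfderiv_chartVector hy u, h, map_zero]
      rfl
    have h2 := congrArg (fun z : R2 ↦ z 1) h1
    exact h0.ne (by simpa [hu] using h2)
  rw [inner_chartVector] at h1
  refine pos_of_mul_pos_right (a := chartMetric y₀ 0 0 y) (lt_of_lt_of_eq h1 ?_) h0.le
  simp [form, hu]
  ring

variable [IsContMDiffRiemannianBundle (𝓡 2) ∞ (EuclideanSpace ℝ (Fin 2))
      (fun y : N ↦ TangentSpace (𝓡 2) y)]

theorem contDiffOn_chartMetric (y₀ : N) (i j : Fin 2) :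
    ContDiffOn ℝ ∞ (fun z ↦ chartMetric y₀ i j ((extChartAt (𝓡 2) y₀).symm z))
      (extChartAt (𝓡 2) y₀).target := by
  have h : ∀ i : Fin 2, ContMDiffOn (𝓡 2) (𝓡 2).tangent ∞
      (fun y ↦ (⟨y, chartVector y₀ y (EuclideanSpace.single i 1)⟩ : TangentBundle (𝓡 2) N))
      (chartAt R2 y₀).source := fun i ↦
    contMDiffOn_chartVector (chartAt R2 y₀).open_source subset_rfl contMDiffOn_const
  have h1 : ContMDiffOn (𝓡 2) 𝓘(ℝ, ℝ) ∞ (chartMetric y₀ i j) (chartAt R2 y₀).source :=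
    (h i).inner_bundle (h j)
  rw [← contMDiffOn_iff_contDiffOn]
  refine h1.comp (contMDiffOn_extChartAt_symm y₀) fun z hz ↦ ?_
  rw [← extChartAt_source (𝓡 2)]
  exact (extChartAt (𝓡 2) y₀).map_target hz

end BCV

theorem theorem3p1 {N : Type*} [TopologicalSpace N] [ChartedSpace (EuclideanSpace ℝ (Fin 2)) N]
    [IsManifold (𝓡 2) ∞ N] [Bundle.RiemannianBundle (fun y : N ↦ TangentSpace (𝓡 2) y)]
    [IsContMDiffRiemannianBundle (𝓡 2) ∞ (EuclideanSpace ℝ (Fin 2))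
      (fun y : N ↦ TangentSpace (𝓡 2) y)]
    (m l : ℝ) (hR : 4 * m - l ^ 2 ≠ 0)
    (Ω : Set BCV.R3) (hΩ : IsOpen Ω) (hΩm : Ω ⊆ BCV.space m)
    (φ : BCV.R3 → N) (hφ : BCV.IsRiemannianSubmersionOn m l φ Ω)
    (p : BCV.R3) (hp : p ∈ Ω)
    (hE3 : (∀ᶠ q in 𝓝 p, BCV.IsVertical φ q (BCV.E3 q)) ∨ ¬ BCV.IsVertical φ p (BCV.E3 p)) :
    ∃ U : Set BCV.R3, IsOpen U ∧ p ∈ U ∧ U ⊆ Ω ∧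
      ∃ e₁ e₂ e₃ : BCV.R3 → BCV.R3, BCV.IsAdaptedFrameOn m l φ e₁ e₂ e₃ U ∧
        ∃ a b : BCV.R3 → ℝ, ContDiffOn ℝ ∞ a U ∧ ContDiffOn ℝ ∞ b U ∧
          ∀ q ∈ U, e₁ q = a q • BCV.E1 m l q + b q • BCV.E2 m l q := by
  open BCV in
  -- Pass to the coordinates of the chart of the base at `φ p`.
  set χ := extChartAt (𝓡 2) (φ p) with hχ
  set W : Set R3 := Ω ∩ φ ⁻¹' (chartAt R2 (φ p)).source with hW
  have hWo : IsOpen W :=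
    hφ.smooth.continuousOn.isOpen_inter_preimage hΩ (chartAt R2 (φ p)).open_source
  have hpW : p ∈ W := ⟨hp, mem_chart_source R2 (φ p)⟩
  have hΦ : ContDiffOn ℝ ∞ (χ ∘ φ) W := by
    rw [← contMDiffOn_iff_contDiffOn]
    exact contMDiffOn_extChartAt.comp (hφ.smooth.mono Set.inter_subset_left) fun q hq ↦ hq.2
  have : IsManifold (𝓡 2) 1 N := .of_le (n := ∞) (by simp)
  have hd : ∀ q ∈ W, ∀ u : R3, fderiv ℝ (χ ∘ φ) q u =
      mfderiv (𝓡 2) 𝓘(ℝ, R2) χ (φ q) (diff φ q u) := by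
    intro q hq u
    rw [← mfderiv_eq_fderiv, mfderiv_comp q (mdifferentiableAt_extChartAt hq.2)
      ((hφ.smooth.contMDiffAt (hΩ.mem_nhds hq.1)).mdifferentiableAt (by simp))]
    rfl
  have hd' : ∀ q ∈ W, ∀ u : R3, chartVector (φ p) (φ q) (fderiv ℝ (χ ∘ φ) q u) = diff φ q u := by
    intro q hq u
    rw [hd q hq]
    exact chartVector_mfderiv hq.2 _
  have hker : ∀ q ∈ W, ∀ u : R3, fderiv ℝ (χ ∘ φ) q u = 0 ↔ IsVertical φ q u := by
    intro q hq u
    constructor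
    · intro h
      rw [IsVertical, ← hd' q hq, h, map_zero]
    · intro h
      rw [hd q hq, h, map_zero]
      rfl
  have hmaps : Set.MapsTo (χ ∘ φ) W χ.target := fun q hq ↦ χ.map_source (by
    rw [hχ, extChartAt_source]; exact hq.2)
  have hinv : ∀ q ∈ W, χ.symm ((χ ∘ φ) q) = φ q := fun q hq ↦ χ.left_inv (by
    rw [hχ, extChartAt_source]; exact hq.2)
  have hmem : ∀ z ∈ χ.target, χ.symm z ∈ (chartAt R2 (φ p)).source := fun z hz ↦ by
    rw [← extChartAt_source (𝓡 2)]
    exact χ.map_target hz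
  have hsub : IsCoordinateSubmersion m l (χ ∘ φ) W χ.target
      (fun z ↦ chartMetric (φ p) 0 0 (χ.symm z)) (fun z ↦ chartMetric (φ p) 0 1 (χ.symm z))
      (fun z ↦ chartMetric (φ p) 1 1 (χ.symm z)) := by
    refine ⟨hWo, fun q hq ↦ hΩm hq.1, hΦ, fun q hq u ↦ ?_, isOpen_extChartAt_target _, hmaps,
      contDiffOn_chartMetric _ _ _, contDiffOn_chartMetric _ _ _, contDiffOn_chartMetric _ _ _,
      fun z hz ↦ chartMetric_pos (hmem z hz), fun z hz ↦ chartMetric_det_pos (hmem z hz),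
      fun q hq u v hu hv ↦ ?_⟩
    · obtain ⟨w, hw⟩ := hφ.submersion q hq.1 (chartVector (φ p) (φ q) u)
      refine ⟨w, ?_⟩
      rw [hd q hq, hw]
      exact mfderiv_chartVector hq.2 u
    · rw [← hφ.isometry q hq.1 u v (fun w hw ↦ hu w ((hker q hq w).mpr hw))
        (fun w hw ↦ hv w ((hker q hq w).mpr hw)), hinv q hq, ← inner_chartVector, hd' q hq,
        hd' q hq]
  obtain ⟨U, hU, hpU, hUW, e₁, e₂, e₃, hframe, hvert, ⟨V, η₁, η₂, hV, hVsub, hUV, hη₁, hη₂, n₁, n₂,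
      n₁₂, hrel⟩, α, β, hα, hβ, he⟩ : HasAdaptedFrameNear m l (χ ∘ φ) W χ.target
      (fun z ↦ chartMetric (φ p) 0 0 (χ.symm z)) (fun z ↦ chartMetric (φ p) 0 1 (χ.symm z))
      (fun z ↦ chartMetric (φ p) 1 1 (χ.symm z)) p := by
    rcases hE3 with hE | hE
    · obtain ⟨O, hO, hOo, hpO⟩ := eventually_nhds_iff.mp hE
      obtain ⟨U, hU, hpU, hUW, h⟩ :=
        (hsub.restrict (hWo.inter hOo) Set.inter_subset_left).hasAdaptedFrameNear_of_vertical
          ⟨hpW, hpO⟩ fun q hq ↦ (hker q hq.1 _).mpr (hO q hq.2)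
      exact ⟨U, hU, hpU, hUW.trans Set.inter_subset_left, h⟩
    · exact hsub.hasAdaptedFrameNear_of_not_vertical hR hpW fun h ↦ hE ((hker p hpW _).mp h)
  have hV' : IsOpen ((chartAt R2 (φ p)).source ∩ χ ⁻¹' V) :=
    (contMDiffOn_extChartAt (n := ∞)).continuousOn.isOpen_inter_preimage
      (chartAt R2 (φ p)).open_source hV
  have hleft : ∀ y ∈ (chartAt R2 (φ p)).source, χ.symm (χ y) = y := fun y hy ↦ χ.left_inv (by
    rw [hχ, extChartAt_source]; exact hy)
  have hηs : ∀ η : R2 → R2, ContDiffOn ℝ ∞ η V → ContMDiffOn (𝓡 2) (𝓡 2).tangent ∞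
      (fun y ↦ (⟨y, chartVector (φ p) y (η (χ y))⟩ : TangentBundle (𝓡 2) N))
      ((chartAt R2 (φ p)).source ∩ χ ⁻¹' V) := by
    intro η hη
    exact contMDiffOn_chartVector hV' Set.inter_subset_left
      (hη.contMDiffOn.comp (contMDiffOn_extChartAt.mono Set.inter_subset_left) fun y hy ↦ hy.2)
  refine ⟨U, hU, hpU, fun q hq ↦ (hUW hq).1, e₁, e₂, e₃, ⟨hframe,
    fun q hq ↦ (hker q (hUW hq) _).mp (hvert q hq), (chartAt R2 (φ p)).source ∩ χ ⁻¹' V,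
    fun y ↦ chartVector (φ p) y (η₁ (χ y)), fun y ↦ chartVector (φ p) y (η₂ (χ y)), hV',
    fun q hq ↦ ⟨(hUW hq).2, hUV hq⟩, ⟨hηs η₁ hη₁, hηs η₂ hη₂, fun y hy ↦ ?_, fun y hy ↦ ?_,
      fun y hy ↦ ?_⟩, fun q hq ↦ ⟨?_, ?_⟩⟩, α, β, hα, hβ, he⟩
  · have := n₁ (χ y) hy.2
    beta_reduce at this
    rwa [hleft y hy.1, ← inner_chartVector] at this
  · have := n₂ (χ y) hy.2
    beta_reduce at this
    rwa [hleft y hy.1, ← inner_chartVector] at this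
  · have := n₁₂ (χ y) hy.2
    beta_reduce at this
    rwa [hleft y hy.1, ← inner_chartVector] at this
  · rw [← hd' q (hUW hq), (hrel q hq).1]
    rfl
  · rw [← hd' q (hUW hq), (hrel q hq).2]
    rfl
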